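/- Let $(\mathcal S,\mathcal A,P,R,\gamma)$ be a Markov decision process with finite $\mathcal S,\mathcal A$, discount $\gamma\in(0,1)$, and rewards almost surely in $[R_{\min},R_{\max}]$; put $V_{\min}=R_{\min}/(1-\gamma)$, $V_{\max}=R_{\max}/(1-\gamma)$. Let $\pi(a\mid s)$ be a policy and let $Z^\pi(s,a)$ be the law of $\sum_{t\ge0}\gamma^t r_t$ under the rollout $s_0=s$, $a_0=a$, $r_t\sim R(\cdot\mid s_t,a_t)$, $s_{t+1}\sim P(\cdot\mid s_t,a_t)$, $a_{t+1}\sim\pi(\cdot\mid s_{t+1})$; let $Q^\pi(s,a)$ be its mean. For a distribution $\mu$ on $\mathbb R$ with CDF $F_\mu$ let $F_\mu^{-1}(\tau)=\inf\{x:\tau\le F_\mu(x)\}$, $\Phi_g(\mu)=\int_0^1F_\mu^{-1}(\tau)g(\tau)\,d\tau$ and $\mathrm{CVaR}_\xi(\mu)=\xi^{-1}\int_0^\xi F_\mu^{-1}(\tau)\,d\tau$. Assume that for some $\zeta>0$ and all $(s,a)$ the CDF of $Z^\pi(s,a)$ is smooth on $[V_{\min},V_{\max}]$ with derivative at least $\zeta$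 there. The dataset $\mathcal D=\{(s_i,a_i,r_i,s_i')\}_{i\le N}$ has fixed pairs $(s_i,a_i)$ and independent $r_i\sim R(\cdot\mid s_i,a_i)$, $s_i'\sim P(\cdot\mid s_i,a_i)$, independent over $i$. Let $n(s,a)$ be the number of $i$ with $(s_i,a_i)=(s,a)$, and let $\hat\pi_\beta(a\mid s)=n(s,a)/\sum_b n(s,b)$ (zero if the denominator is zero). Write $s\in\mathcal D$ if $s$ is one of the $s_i$ or $s_i'$. The dataset has \emph{coverage} if $\hat\pi_\beta(a\mid s)>0$ for all $s\in\mathcal D$, $a\in\mathcal A$. Let $\hat P(\cdot\mid s,a)$ and $\hat R(\cdot\mid s,a)$ be the empirical distributions of the $s_i'$ and of the $r_i$ with $(s_i,a_i)=(s,a)$, and let $\hat{\mathcal T}^\pi Z(s,a)$ be the law of $r+\gamma z$ with $r\sim\hat R(\cdot\mid s,a)$ independent of $(s',a',z)$, where $s'\sim\hat P(\cdot\mid s,a)$, $a'\sim\pi(\cdot\mid s')$, $z\sim Z(s',a')$. For $p>1$, $\alpha>0$ and costs $c_0$ let $c(s,a)=|\alpha p^{-1}c_0(s,a)|^{1/(p-1)}\operatorname{sign}(c_0(s,a))$,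 and let $\tilde{\mathcal T}^\pi Z(s,a)$ be $\hat{\mathcal T}^\pi Z(s,a)$ translated by $-c(s,a)$, i.e. with all quantiles lowered by $c(s,a)$. \textbf{Claim.} Let $p>1$, $\delta>0$, let $c_0(s,a)>0$ for all $(s,a)$, and let $\alpha>0$ be so large that $$\alpha\ \ge\ \frac{p\,\Delta(s,a)^{p-1}}{c_0(s,a)}\quad\text{whenever } n(s,a)>0,\qquad \Delta(s,a)=\frac1\zeta\sqrt{\frac{5|\mathcal S|}{n(s,a)}\log\frac{4|\mathcal S||\mathcal A|}{\delta}}$$ (the square root being read as $0$ if its argument is negative). If the dataset has coverage, then $\tilde{\mathcal T}^\pi$ has a unique fixed point $\tilde Z^\pi$ among the families $(Z(s,a))_{s\in\mathcal D,a\in\mathcal A}$ of probability distributions on $\mathbb R$ with finite $p$-th moment. Moreover there is an event of probability at least $1-\delta$ on which, if the dataset has coverage, for all $s\in\mathcal D$ and $a\in\mathcal A$: for every probability density $g$ on $[0,1]$ the integrals defining $\Phi_g(Z^\pi(s,a))$ and $\Phi_g(\tilde Z^\pi(s,a))$ converge and $$\Phi_g(Z^\pi(s,a))\ \ge\ \Phi_g(\tilde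 Z^\pi(s,a));$$ in particular $Q^\pi(s,a)\ge\tilde Q^\pi(s,a)$, where $\tilde Q^\pi(s,a)$ is the mean of $\tilde Z^\pi(s,a)$, and $\mathrm{CVaR}_\xi(Z^\pi(s,a))\ge\mathrm{CVaR}_\xi(\tilde Z^\pi(s,a))$ for all $\xi\in(0,1]$. -/

import Mathlib

open MeasureTheory ProbabilityTheory Set
open scoped ENNReal

/-- A Markov decision process `(S, A, P, R, γ)` with discount factor `γ ∈ (0,1)` and rewards
almost surely in `[Rmin, Rmax]`. -/
structure MDP (S A : Type*) where
  /-- transition distribution `P(· ∣ s, a)` -/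
  P : S → A → PMF S
  /-- reward distribution `R(· ∣ s, a)` -/
  R : S → A → ProbabilityMeasure ℝ
  /-- discount factor -/
  γ : ℝ
  γ_pos : 0 < γ
  γ_lt_one : γ < 1
  Rmin : ℝ
  Rmax : ℝ
  reward_mem : ∀ s a, ∀ᵐ r ∂(R s a : Measure ℝ), r ∈ Icc Rmin Rmax

noncomputable section

namespace MDP

/-- Lower end of the range of returns. -/
def Vmin {S A : Type*} (M : MDP S A) : ℝ := M.Rmin / (1 - M.γ)

/-- Upper end of the range of returns. -/
def Vmax {S A : Type*} (M : MDP S A) : ℝ := M.Rmax / (1 - M.γ)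

end MDP

/-! ### Rollouts and returns -/

/-- Law of the next triple `(s', a', r')` of a rollout under the policy `pol`, given the current
state-action pair: `s' ∼ P(· ∣ s, a)`, `a' ∼ pol(· ∣ s')`, `r' ∼ R(· ∣ s', a')`. -/
def stepLaw {S A : Type*} [Fintype S] [Fintype A] [MeasurableSpace S] [MeasurableSpace A]
    (M : MDP S A) (pol : S → PMF A) (q : S × A) : Measure (S × A × ℝ) :=
  ∑ s' : S, ∑ a' : A, (M.P q.1 q.2 s' * pol s' a') •
    (M.R s' a' : Measure ℝ).map (fun r => (s', a', r))

theorem isProbabilityMeasure_stepLaw {S A : Type*} [Fintype S] [Fintype A]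
    [MeasurableSpace S] [MeasurableSpace A]
    (M : MDP S A) (pol : S → PMF A) (q : S × A) :
    IsProbabilityMeasure (stepLaw M pol q) := by
  have hm : ∀ (s' : S) (a' : A),
      ((M.R s' a' : Measure ℝ).map (fun r => (s', a', r))) univ = 1 := by
    intro s' a'
    rw [Measure.map_apply (by fun_prop) MeasurableSet.univ]
    simp
  have hA : ∀ s', ∑ a' : A, pol s' a' = 1 := fun s' => by
    rw [← tsum_fintype (L := .unconditional _)]; exact (pol s').tsum_coe
  have hS : ∑ s' : S, M.P q.1 q.2 s' = 1 := by
    rw [← tsum_fintype (L := .unconditional _)]; exact (M.P q.1 q.2).tsum_coe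
  constructor
  simp only [stepLaw, Measure.finsetSum_apply, Measure.smul_apply, hm, smul_eq_mul, mul_one]
  simp [← Finset.mul_sum, hA, hS]

/-- The same as a Markov kernel on histories: the law of `(s_{n+1}, a_{n+1}, r_{n+1})` given
`(s_0, a_0, r_0), …, (s_n, a_n, r_n)` only depends on `(s_n, a_n)`. -/
def stepKernel {S A : Type*} [Fintype S] [Fintype A] [MeasurableSpace S] [MeasurableSpace A]
    [MeasurableSingletonClass S] [MeasurableSingletonClass A]
    (M : MDP S A) (pol : S → PMF A) (n : ℕ) :
    Kernel ((i : Finset.Iic n) → (fun _ : ℕ => S × A × ℝ) i) (S × A × ℝ) :=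
  (Kernel.ofFunOfCountable (stepLaw M pol)).comap
    (fun h => ((h ⟨n, Finset.mem_Iic.2 le_rfl⟩).1, (h ⟨n, Finset.mem_Iic.2 le_rfl⟩).2.1))
    (by fun_prop)

instance isMarkovKernel_stepKernel {S A : Type*} [Fintype S] [Fintype A]
    [MeasurableSpace S] [MeasurableSpace A]
    [MeasurableSingletonClass S] [MeasurableSingletonClass A]
    (M : MDP S A) (pol : S → PMF A) (n : ℕ) : IsMarkovKernel (stepKernel M pol n) := by
  have : IsMarkovKernel (Kernel.ofFunOfCountable (stepLaw M pol)) :=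
    ⟨fun q => isProbabilityMeasure_stepLaw M pol q⟩
  unfold stepKernel
  infer_instance

/-- The distribution of rollouts `((s_0, a_0, r_0), (s_1, a_1, r_1), …)` of the policy `pol` from
state `s_0 = s` with initial action `a_0 = a`. -/
def rolloutLaw {S A : Type*} [Fintype S] [Fintype A] [MeasurableSpace S] [MeasurableSpace A]
    [MeasurableSingletonClass S] [MeasurableSingletonClass A]
    (M : MDP S A) (pol : S → PMF A) (s : S) (a : A) : Measure (ℕ → S × A × ℝ) :=
  Kernel.trajMeasure (X := fun _ => S × A × ℝ)
    ((M.R s a : Measure ℝ).map (fun r => (s, a, r))) (stepKernel M pol)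

/-- The discounted cumulative reward of a rollout. -/
def discountedReturn {S A : Type*} (M : MDP S A) (ξ : ℕ → S × A × ℝ) : ℝ :=
  ∑' t, M.γ ^ t * (ξ t).2.2

/-- The return distribution `Z^π(s, a)`. -/
def returnLaw {S A : Type*} [Fintype S] [Fintype A] [MeasurableSpace S] [MeasurableSpace A]
    [MeasurableSingletonClass S] [MeasurableSingletonClass A]
    (M : MDP S A) (pol : S → PMF A) (s : S) (a : A) : Measure ℝ :=
  (rolloutLaw M pol s a).map (discountedReturn M)

/-- The `Q`-function of the policy `pol`. -/
def qFunction {S A : Type*} [Fintype S] [Fintype A] [MeasurableSpace S] [MeasurableSpace A]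
    [MeasurableSingletonClass S] [MeasurableSingletonClass A]
    (M : MDP S A) (pol : S → PMF A) (s : S) (a : A) : ℝ :=
  ∫ ξ, discountedReturn M ξ ∂(rolloutLaw M pol s a)

/-- The regularity condition on the returns: on `[Vmin, Vmax]` every CDF of a return distribution
is smooth and has derivative at least `ζ` (one-sided derivatives at the two end points). -/
def StronglyMonotoneReturns {S A : Type*} [Fintype S] [Fintype A]
    [MeasurableSpace S] [MeasurableSpace A]
    [MeasurableSingletonClass S] [MeasurableSingletonClass A]
    (M : MDP S A) (pol : S → PMF A) (ζ : ℝ) : Prop :=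
  ∀ s a, ContDiffOn ℝ ((⊤ : ℕ∞) : WithTop ℕ∞) (cdf (returnLaw M pol s a)) (Icc M.Vmin M.Vmax) ∧
    ∀ x ∈ Icc M.Vmin M.Vmax,
      ζ ≤ derivWithin (cdf (returnLaw M pol s a)) (Icc M.Vmin M.Vmax) x

/-! ### Quantiles and distorted expectations -/

/-- The quantile function `F⁻¹(τ) = inf {x ∣ τ ≤ F(x)}` of a distribution on `ℝ`. -/
def quantile (μ : Measure ℝ) (τ : ℝ) : ℝ := sInf {x | τ ≤ cdf μ x}

/-- `g` is a probability density on `[0, 1]`. -/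
def IsDistortionDensity (g : ℝ → ℝ) : Prop :=
  (∀ τ ∈ Icc (0 : ℝ) 1, 0 ≤ g τ) ∧ IntervalIntegrable g volume 0 1 ∧ ∫ τ in (0 : ℝ)..1, g τ = 1

/-- The distorted expectation `Φ_g`. -/
def distortedExpectation (g : ℝ → ℝ) (μ : Measure ℝ) : ℝ :=
  ∫ τ in (0 : ℝ)..1, quantile μ τ * g τ

/-- Conditional value at risk at level `ξ`: the average of the quantiles below level `ξ`. -/
def cvar (ξ : ℝ) (μ : Measure ℝ) : ℝ := ξ⁻¹ * ∫ τ in (0 : ℝ)..ξ, quantile μ τ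

/-! ### The dataset -/

/-- The law of the random part `(r_i, s'_i)` of a dataset `(s_i, a_i, r_i, s'_i)`, `i < N`, with
queried pairs `x i = (s_i, a_i)`: independently, `r_i ∼ R(· ∣ s_i, a_i)` and
`s'_i ∼ P(· ∣ s_i, a_i)`. -/
def dataLaw {S A : Type*} [MeasurableSpace S] (M : MDP S A) {N : ℕ} (x : Fin N → S × A) :
    Measure (Fin N → ℝ × S) :=
  Measure.pi fun i =>
    (M.R (x i).1 (x i).2 : Measure ℝ).prod (M.P (x i).1 (x i).2).toMeasure

/-- `n(s, a)`, the number of times `(s, a)` occurs in the dataset. -/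
def visits {S A : Type*} [DecidableEq S] [DecidableEq A] {N : ℕ} (x : Fin N → S × A)
    (s : S) (a : A) : ℕ :=
  (Finset.univ.filter fun i => x i = (s, a)).card

/-- The empirical behavior policy `π̂_β(a ∣ s)` (zero when no transition starts from `s`). -/
def behaviorPolicy {S A : Type*} [DecidableEq S] [DecidableEq A] {N : ℕ} (x : Fin N → S × A)
    (s : S) (a : A) : ℝ :=
  (visits x s a : ℝ) / ((Finset.univ.filter fun i => (x i).1 = s).card : ℝ)

/-- The states occurring in the dataset, at the beginning or at the end of a transition. -/
def dataStates {S A : Type*} {N : ℕ} (x : Fin N → S × A) (ω : Fin N → ℝ × S) : Set S :=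
  {s | ∃ i, (x i).1 = s ∨ (ω i).2 = s}

/-- Nonzero coverage of all actions in all states of the dataset. -/
def Covers {S A : Type*} [DecidableEq S] [DecidableEq A] {N : ℕ} (x : Fin N → S × A)
    (ω : Fin N → ℝ × S) : Prop :=
  ∀ s ∈ dataStates x ω, ∀ a, 0 < behaviorPolicy x s a

/-- The empirical transition probabilities `P̂(s' ∣ s, a)`. -/
def empiricalP {S A : Type*} [DecidableEq S] [DecidableEq A] {N : ℕ} (x : Fin N → S × A)
    (ω : Fin N → ℝ × S) (s : S) (a : A) (s' : S) : ℝ≥0∞ :=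
  ((Finset.univ.filter fun i => x i = (s, a) ∧ (ω i).2 = s').card : ℝ≥0∞) / (visits x s a : ℝ≥0∞)

/-- The empirical reward distribution `R̂(· ∣ s, a)`. -/
def empiricalR {S A : Type*} [DecidableEq S] [DecidableEq A] {N : ℕ} (x : Fin N → S × A)
    (ω : Fin N → ℝ × S) (s : S) (a : A) : Measure ℝ :=
  (visits x s a : ℝ≥0∞)⁻¹ •
    ∑ i ∈ Finset.univ.filter (fun i => x i = (s, a)), Measure.dirac (ω i).1

/-! ### The conservative distribution evaluation operator -/

/-- The distributional Bellman operator with transition probabilities `P` and reward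
distributions `R`: the law of `r + γ z`, where `r ∼ R(s, a)` is independent of `(s', a')` with
`s' ∼ P(s, a)`, `a' ∼ pol(s')`, and `z ∼ Z(s', a')`. -/
def bellmanOp {S A : Type*} [Fintype S] [Fintype A] (γ : ℝ) (P : S → A → S → ℝ≥0∞)
    (R : S → A → Measure ℝ) (pol : S → PMF A) (Z : S → A → Measure ℝ) (s : S) (a : A) :
    Measure ℝ :=
  ∑ s' : S, ∑ a' : A, (P s a s' * pol s' a') •
    ((R s a).prod (Z s' a')).map (fun u => u.1 + γ * u.2)

/-- The empirical distributional Bellman operator `T̂^π`, with `P`, `R` replaced by `P̂`, `R̂`. -/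
def empiricalBellmanOp {S A : Type*} [Fintype S] [Fintype A] [DecidableEq S] [DecidableEq A]
    (M : MDP S A) (pol : S → PMF A) {N : ℕ} (x : Fin N → S × A) (ω : Fin N → ℝ × S) :
    (S → A → Measure ℝ) → S → A → Measure ℝ :=
  bellmanOp M.γ (empiricalP x ω) (empiricalR x ω) pol

/-- The amount `c(s, a)` by which quantiles are lowered, for penalty weight `α`, exponent `p` and
costs `c₀`. -/
def penalty {S A : Type*} (p α : ℝ) (c₀ : S → A → ℝ) (s : S) (a : A) : ℝ :=
  |α * p⁻¹ * c₀ s a| ^ (1 / (p - 1)) * Real.sign (c₀ s a)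

/-- The shift operator `O_c`: translating the distribution `Z(s, a)` by `-c(s, a)`, that is,
lowering all its quantiles by `c(s, a)`. -/
def shiftOp {S A : Type*} (c : S → A → ℝ) (Z : S → A → Measure ℝ) (s : S) (a : A) : Measure ℝ :=
  (Z s a).map (fun z => z - c s a)

/-- Shifting a distribution lowers its quantile function by the corresponding constant. -/
theorem quantile_shiftOp {S A : Type*} (c : S → A → ℝ) (Z : S → A → Measure ℝ) (s : S) (a : A)
    [IsProbabilityMeasure (Z s a)] {τ : ℝ} (hτ : τ ∈ Ioo (0 : ℝ) 1) :
    quantile (shiftOp c Z s a) τ = quantile (Z s a) τ - c s a := by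
  have hprob : IsProbabilityMeasure (shiftOp c Z s a) :=
    Measure.isProbabilityMeasure_map (by fun_prop)
  have hF : ∀ y, cdf (shiftOp c Z s a) y = cdf (Z s a) (y + c s a) := by
    intro y
    rw [cdf_eq_real, cdf_eq_real, shiftOp, map_measureReal_apply (by fun_prop) measurableSet_Iic]
    congr 1
    ext z
    simp
  have hne : {y | τ ≤ cdf (Z s a) y}.Nonempty :=
    ((tendsto_cdf_atTop (Z s a)).eventually (eventually_ge_nhds hτ.2)).exists
  have hbdd : BddBelow {y | τ ≤ cdf (Z s a) y} := by
    obtain ⟨b, hb⟩ := ((tendsto_cdf_atBot (Z s a)).eventually (eventually_lt_nhds hτ.1)).exists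
    refine ⟨b, fun y hy => ?_⟩
    by_contra hlt
    exact absurd (hy.trans (monotone_cdf (Z s a) (not_le.1 hlt).le)) (not_le.2 hb)
  have himg : {y | τ ≤ cdf (shiftOp c Z s a) y} =
      (OrderIso.addRight (-(c s a))) '' {y | τ ≤ cdf (Z s a) y} := by
    ext y
    simp only [hF, Set.mem_ofPred_eq, mem_image, OrderIso.addRight_apply]
    constructor
    · intro h
      exact ⟨y + c s a, h, by ring⟩
    · rintro ⟨z, hz, rfl⟩
      simpa using hz
  rw [quantile, quantile, himg, ← OrderIso.map_csInf' _ hne hbdd]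
  simp [sub_eq_add_neg]

/-- The CDE operator `T̃^π = O_c T̂^π`. -/
def cdeOp {S A : Type*} [Fintype S] [Fintype A] [DecidableEq S] [DecidableEq A]
    (M : MDP S A) (pol : S → PMF A) (p α : ℝ) (c₀ : S → A → ℝ)
    {N : ℕ} (x : Fin N → S × A) (ω : Fin N → ℝ × S) (Z : S → A → Measure ℝ) :
    S → A → Measure ℝ :=
  shiftOp (penalty p α c₀) (empiricalBellmanOp M pol x ω Z)

/-- `Z` is a fixed point of the CDE operator in the space of families of probability distributions
with finite `p`-th moment. The states concerned are those of the dataset; if the dataset has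
coverage, the operator there only involves the values of `Z` at states of the dataset. -/
def IsCDEFixedPoint {S A : Type*} [Fintype S] [Fintype A] [DecidableEq S] [DecidableEq A]
    (M : MDP S A) (pol : S → PMF A) (p α : ℝ) (c₀ : S → A → ℝ)
    {N : ℕ} (x : Fin N → S × A) (ω : Fin N → ℝ × S) (Z : S → A → Measure ℝ) : Prop :=
  ∀ s ∈ dataStates x ω, ∀ a, IsProbabilityMeasure (Z s a) ∧
    Integrable (fun z => |z| ^ p) (Z s a) ∧ cdeOp M pol p α c₀ x ω Z s a = Z s a

/-- The estimation error bound
`Δ(s, a) = ζ⁻¹ √(5 |S| / n(s, a) · log (4 |S| |A| / δ))`. -/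
def estimationError {S A : Type*} [Fintype S] [Fintype A] [DecidableEq S] [DecidableEq A]
    (ζ δ : ℝ) {N : ℕ} (x : Fin N → S × A) (s : S) (a : A) : ℝ :=
  1 / ζ * √(5 * Fintype.card S / visits x s a *
    Real.log (4 * Fintype.card S * Fintype.card A / δ))

end

/-! The argument is a comparison principle for the shifted empirical Bellman operator, combined with
a proof that the true return laws form a sub-solution of it.

Comparison. Measure the excess of one family of CDFs over another by the integral over the line of
the positive part of the difference. A Bellman update averages over rewards and successors and
rescales the argument by the discount, so it multiplies the largest excess by at most `γ`; the
translation by `c` does not change it. First moments make the excess finite, so a sub-solution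
cannot exceed a super-solution at all (`measure_Iic_le_of_bellmanOp`). Applied in both directions
this gives uniqueness of the fixed point. Existence needs no completeness argument: the return laws
of the empirical decision process with rewards lowered by `c` solve the equation, by the
distributional Bellman equation `MDP.bellmanOp_returnLaw`. This also shows that the fixed point has
bounded support.

Sub-solution. The true return laws satisfy the true Bellman equation. Replacing the true rewards and
transitions by empirical ones lowers a CDF by at most `ε₁ + ε₂`, where `ε₁` bounds the reward CDF
error and `ε₂` the transition error on sets of states (`IsAccurate.bellmanOp_sub_le`). Translating
by `c` moves the argument from `y` to `y + c`, and the lower bound `ζ` on the density gains at least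
`ζ c`. The size of `α` makes `c` at least `Δ`, which dominates `(ε₁ + ε₂) / ζ`
(`returnLaw_Iic_le_cdeOp`, `sqrt_add_sqrt_div_le_penalty`).

Concentration. `ε₂` comes from Hoeffding's inequality and a union bound over subsets of the state
space. `ε₁` comes from a uniform bound for empirical CDFs, proved by a Doob-type maximal inequality:
along a decreasing family of sets, frequencies divided by probabilities form a martingale, and
exponentiating gives a submartingale.

Pointwise order of CDFs reverses into order of quantiles, hence of all distorted expectations; means
are compared directly through the CDFs. -/

/-! ### Markov measures on trajectory space -/

namespace Trajectory

variable {X : Type*}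

/-- The history `(x_0, …, x_n)` of a trajectory. -/
def history (n : ℕ) (ξ : ℕ → X) : (i : Finset.Iic n) → (fun _ : ℕ => X) i := fun i => ξ i

/-- Appending a last element to a history. -/
def snocHistory (n : ℕ) (h : ((i : Finset.Iic n) → (fun _ : ℕ => X) i) × X) :
    (i : Finset.Iic (n + 1)) → (fun _ : ℕ => X) i :=
  fun i => if hi : (i : ℕ) ≤ n then h.1 ⟨i, Finset.mem_Iic.2 hi⟩ else h.2

/-- Prepending an element to a history. -/
def consHistory (n : ℕ) (x : X) (h : (i : Finset.Iic n) → (fun _ : ℕ => X) i) :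
    (i : Finset.Iic (n + 1)) → (fun _ : ℕ => X) i :=
  fun i => if hi : (i : ℕ) = 0 then x else
    h ⟨i - 1, Finset.mem_Iic.2 (by have := Finset.mem_Iic.1 i.2; omega)⟩

/-- Prepending an element to a trajectory. -/
def consTraj (u : X × (ℕ → X)) : ℕ → X := fun n => Nat.casesOn n u.1 u.2

theorem snocHistory_history (n : ℕ) (ξ : ℕ → X) :
    snocHistory n (history n ξ, ξ (n + 1)) = history (n + 1) ξ := by
  funext i
  have := Finset.mem_Iic.1 i.2
  by_cases hi : (i : ℕ) ≤ n
  · simp [snocHistory, history, hi]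
  · have : (i : ℕ) = n + 1 := by omega
    simp [snocHistory, history, this]

theorem history_consTraj (n : ℕ) (x : X) (ξ : ℕ → X) :
    history (n + 1) (consTraj (x, ξ)) = consHistory n x (history n ξ) := by
  funext ⟨i, hi⟩
  cases i <;> simp [consHistory, history, consTraj]

theorem history_zero_consTraj (x : X) (ξ : ℕ → X) :
    history 0 (consTraj (x, ξ)) = fun _ => x := by
  funext ⟨i, hi⟩
  have : i = 0 := by simpa using hi
  subst this
  rfl

variable [MeasurableSpace X]

@[fun_prop]
theorem measurable_history (n : ℕ) : Measurable (history (X := X) n) :=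
  measurable_pi_iff.2 fun _ => measurable_pi_apply _

@[fun_prop]
theorem measurable_snocHistory (n : ℕ) : Measurable (snocHistory (X := X) n) := by
  refine measurable_pi_iff.2 fun i => ?_
  unfold snocHistory
  split_ifs <;> fun_prop

@[fun_prop]
theorem measurable_consHistory (n : ℕ) (x : X) : Measurable (consHistory n x) := by
  refine measurable_pi_iff.2 fun i => ?_
  unfold consHistory
  split_ifs <;> fun_prop

@[fun_prop]
theorem measurable_consTraj : Measurable (consTraj (X := X)) := by
  refine measurable_pi_iff.2 fun n => ?_
  cases n <;> simp only [consTraj] <;> fun_prop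

/-- A measure on trajectories is Markov with transition kernel `K`. -/
def IsMarkovTraj (K : Kernel X X) (μ : Measure (ℕ → X)) : Prop :=
  ∀ (n : ℕ) (F : ((i : Finset.Iic n) → (fun _ : ℕ => X) i) × X → ℝ≥0∞), Measurable F →
    ∫⁻ ξ, F (history n ξ, ξ (n + 1)) ∂μ = ∫⁻ ξ, ∫⁻ y, F (history n ξ, y) ∂(K (ξ n)) ∂μ

/-- Every finite set of times lies in an initial segment, so all finite-dimensional marginals factor
through histories, and a finite measure is determined as the projective limit of its marginals. -/
theorem ext_of_map_history {μ ν : Measure (ℕ → X)} [IsFiniteMeasure μ] [IsFiniteMeasure ν]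
    (h : ∀ n, μ.map (history n) = ν.map (history n)) : μ = ν := by
  have hμ : IsProjectiveLimit μ (fun I : Finset ℕ => ν.map I.restrict) := by
    intro I
    have hI : I ⊆ Finset.Iic (I.sup id) := fun i hi =>
      Finset.mem_Iic.2 (Finset.le_sup (f := id) hi)
    have hr : (I.restrict : (ℕ → X) → _) =
        (Finset.restrict₂ (π := fun _ => X) hI) ∘ history (I.sup id) := rfl
    have hm : Measurable (Finset.restrict₂ (π := fun _ => X) hI) := Finset.measurable_restrict₂ hI
    change μ.map I.restrict = ν.map I.restrict
    rw [hr, ← Measure.map_map hm (by fun_prop), h, Measure.map_map hm (by fun_prop)]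
  exact hμ.unique fun I => rfl

/-- The law of each history is the previous one extended by the kernel, so induction on its length
fixes all of them. This lets rollout laws be identified without unfolding the Ionescu-Tulcea
construction. -/
theorem IsMarkovTraj.ext {K : Kernel X X} [IsMarkovKernel K] {μ ν : Measure (ℕ → X)}
    [IsFiniteMeasure μ] [IsFiniteMeasure ν] (hμ : IsMarkovTraj K μ) (hν : IsMarkovTraj K ν)
    (h0 : μ.map (fun ξ => ξ 0) = ν.map (fun ξ => ξ 0)) : μ = ν := by
  refine ext_of_map_history fun n => ?_
  induction n with
  | zero =>
    have hr : history (X := X) 0 = (fun x _ => x) ∘ fun ξ => ξ 0 := by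
      funext ξ ⟨i, hi⟩
      have : i = 0 := by simpa using hi
      subst this
      rfl
    rw [hr, ← Measure.map_map (by fun_prop) (by fun_prop), h0,
      Measure.map_map (by fun_prop) (by fun_prop)]
  | succ n ih =>
    refine Measure.ext_of_lintegral _ fun f hf => ?_
    have key : ∀ ρ : Measure (ℕ → X), IsMarkovTraj K ρ →
        ∫⁻ h, f h ∂(ρ.map (history (n + 1))) =
          ∫⁻ h, ∫⁻ y, f (snocHistory n (h, y)) ∂(K (h ⟨n, Finset.mem_Iic.2 le_rfl⟩))
            ∂(ρ.map (history n)) := by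
      intro ρ hρ
      rw [lintegral_map hf (by fun_prop), lintegral_map _ (by fun_prop)]
      · have := hρ n (fun u => f (snocHistory n u)) (by fun_prop)
        simp only [snocHistory_history] at this
        exact this
      · exact Measurable.lintegral_kernel_prod_right' (κ := K.comap
            (fun h : (i : Finset.Iic n) → (fun _ : ℕ => X) i => h ⟨n, Finset.mem_Iic.2 le_rfl⟩)
            (by fun_prop)) (f := fun u => f (snocHistory n u)) (by fun_prop)
    rw [key μ hμ, key ν hν, ih]

theorem isMarkovTraj_trajMeasure (K : Kernel X X) [IsMarkovKernel K]
    (μ₀ : Measure X) [IsProbabilityMeasure μ₀]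
    (κ : (n : ℕ) → Kernel ((i : Finset.Iic n) → (fun _ : ℕ => X) i) X) [∀ n, IsMarkovKernel (κ n)]
    (hκ : ∀ n h, κ n h = K (h ⟨n, Finset.mem_Iic.2 le_rfl⟩)) :
    IsMarkovTraj K (Kernel.trajMeasure (X := fun _ => X) μ₀ κ) := by
  intro n F hF
  have h := Kernel.map_frestrictLe_trajMeasure_compProd_eq_map_trajMeasure
    (X := fun _ => X) (μ₀ := μ₀) (κ := κ) (a := n)
  have h2 := congrArg (fun ρ => ∫⁻ u, F u ∂ρ) h
  simp only at h2
  rw [lintegral_map hF (by fun_prop), Measure.lintegral_compProd hF, lintegral_map _ (by fun_prop)]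
    at h2
  · simp only [hκ] at h2
    exact h2.symm
  · exact Measurable.lintegral_kernel_prod_right' hF

theorem map_zero_trajMeasure
    (μ₀ : Measure X) [IsProbabilityMeasure μ₀]
    (κ : (n : ℕ) → Kernel ((i : Finset.Iic n) → (fun _ : ℕ => X) i) X)
    [∀ n, IsMarkovKernel (κ n)] :
    (Kernel.trajMeasure (X := fun _ => X) μ₀ κ).map (fun ξ => ξ 0) = μ₀ := by
  have hr : (fun ξ : ℕ → X => ξ 0) =
      (fun h : (i : Finset.Iic 0) → X => h ⟨0, Finset.mem_Iic.2 le_rfl⟩) ∘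
        Preorder.frestrictLe 0 := rfl
  rw [hr, ← Measure.map_map (by fun_prop) (by fun_prop), Kernel.trajMeasure,
    Measure.map_comp _ _ (by fun_prop), Kernel.traj_map_frestrictLe, Kernel.partialTraj_self,
    Measure.id_comp, Measure.map_map (by fun_prop) (by fun_prop)]
  exact Measure.map_id

end Trajectory

/-! ### Rollouts and the distributional Bellman equation -/

section Rollout

variable {S A : Type*} [Fintype S] [Fintype A] [MeasurableSpace S] [MeasurableSpace A]
  [MeasurableSingletonClass S] [MeasurableSingletonClass A] (M : MDP S A) (pol : S → PMF A)

namespace MDP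

/-- The one-step transition kernel of the state-action-reward chain. -/
noncomputable def chainKernel : Kernel (S × A × ℝ) (S × A × ℝ) :=
  (Kernel.ofFunOfCountable (stepLaw M pol)).comap (fun u => (u.1, u.2.1)) (by fun_prop)

theorem chainKernel_apply (u : S × A × ℝ) :
    chainKernel M pol u = stepLaw M pol (u.1, u.2.1) := rfl

instance : IsMarkovKernel (chainKernel M pol) :=
  ⟨fun u => isProbabilityMeasure_stepLaw M pol (u.1, u.2.1)⟩

instance (s : S) (a : A) :
    IsProbabilityMeasure ((M.R s a : Measure ℝ).map (fun r => (s, a, r))) :=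
  Measure.isProbabilityMeasure_map (by fun_prop)

instance (s : S) (a : A) : IsProbabilityMeasure (rolloutLaw M pol s a) := by
  unfold rolloutLaw; infer_instance

theorem isMarkovTraj_rolloutLaw (s : S) (a : A) :
    Trajectory.IsMarkovTraj (chainKernel M pol) (rolloutLaw M pol s a) :=
  Trajectory.isMarkovTraj_trajMeasure _ _ _ fun _ _ => rfl

theorem map_zero_rolloutLaw (s : S) (a : A) :
    (rolloutLaw M pol s a).map (fun ξ => ξ 0) = (M.R s a : Measure ℝ).map (fun r => (s, a, r)) :=
  Trajectory.map_zero_trajMeasure _ _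

omit [MeasurableSingletonClass S] [MeasurableSingletonClass A] in
theorem lintegral_stepLaw (q : S × A) {f : S × A × ℝ → ℝ≥0∞} (hf : Measurable f) :
    ∫⁻ u, f u ∂(stepLaw M pol q) = ∑ s' : S, ∑ a' : A, (M.P q.1 q.2 s' * pol s' a') *
      ∫⁻ r, f (s', a', r) ∂(M.R s' a' : Measure ℝ) := by
  simp only [stepLaw, lintegral_finsetSum_measure, lintegral_smul_measure, smul_eq_mul]
  refine Finset.sum_congr rfl fun s' _ => Finset.sum_congr rfl fun a' _ => ?_
  rw [lintegral_map hf (by fun_prop)]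

/-- The law of a rollout obtained by sampling the first reward and the second state-action pair,
and continuing with an independent rollout from there. -/
noncomputable def restartLaw (s : S) (a : A) : Measure (ℕ → S × A × ℝ) :=
  ∑ s' : S, ∑ a' : A, (M.P s a s' * pol s' a') •
    ((M.R s a : Measure ℝ).prod (rolloutLaw M pol s' a')).map
      (fun u => Trajectory.consTraj ((s, a, u.1), u.2))

theorem lintegral_restartLaw (s : S) (a : A) {f : (ℕ → S × A × ℝ) → ℝ≥0∞} (hf : Measurable f) :
    ∫⁻ ξ, f ξ ∂(restartLaw M pol s a) = ∑ s' : S, ∑ a' : A, (M.P s a s' * pol s' a') *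
      ∫⁻ r, ∫⁻ ξ, f (Trajectory.consTraj ((s, a, r), ξ)) ∂(rolloutLaw M pol s' a')
        ∂(M.R s a : Measure ℝ) := by
  simp only [restartLaw, lintegral_finsetSum_measure, lintegral_smul_measure, smul_eq_mul]
  refine Finset.sum_congr rfl fun s' _ => Finset.sum_congr rfl fun a' _ => ?_
  rw [lintegral_map hf (by fun_prop), lintegral_prod _ (by fun_prop)]

omit [MeasurableSpace S] [MeasurableSpace A] [MeasurableSingletonClass S]
  [MeasurableSingletonClass A] in
theorem sum_pmf_mul_pmf (q : PMF S) : ∑ s' : S, ∑ a' : A, q s' * pol s' a' = 1 := by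
  have hA : ∀ s', ∑ a' : A, pol s' a' = 1 := fun s' => by
    rw [← tsum_fintype (L := .unconditional _)]; exact (pol s').tsum_coe
  have hS : ∑ s' : S, q s' = 1 := by
    rw [← tsum_fintype (L := .unconditional _)]; exact q.tsum_coe
  simp [← Finset.mul_sum, hA, hS]

instance (s : S) (a : A) : IsProbabilityMeasure (restartLaw M pol s a) := by
  constructor
  have := lintegral_restartLaw M pol s a (f := fun _ => 1) measurable_const
  simpa [sum_pmf_mul_pmf] using this

/-- For the first transition the property is the definition of the step law, as a rollout from `(s',
a')` starts with a reward drawn there. Later transitions take place inside the continuing rollout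
and inherit its Markov property, the first triple being a fixed parameter. -/
theorem isMarkovTraj_restartLaw (s : S) (a : A) :
    Trajectory.IsMarkovTraj (chainKernel M pol) (restartLaw M pol s a) := by
  intro n F hF
  have hm : Measurable fun ξ : ℕ → S × A × ℝ =>
      ∫⁻ y, F (Trajectory.history n ξ, y) ∂(chainKernel M pol (ξ n)) :=
    Measurable.lintegral_kernel_prod_right'
      (κ := (chainKernel M pol).comap (fun ξ : ℕ → S × A × ℝ => ξ n) (by fun_prop))
      (f := fun u => F (Trajectory.history n u.1, u.2)) (by fun_prop)
  rw [lintegral_restartLaw M pol s a (by fun_prop), lintegral_restartLaw M pol s a hm]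
  cases n with
  | zero =>
    simp only [Trajectory.history_zero_consTraj]
    have e : ∀ s' a' r, ∫⁻ ξ, F (fun _ => (s, a, r), Trajectory.consTraj ((s, a, r), ξ) (0 + 1))
        ∂(rolloutLaw M pol s' a') =
        ∫⁻ r', F (fun _ => (s, a, r), (s', a', r')) ∂(M.R s' a' : Measure ℝ) := by
      intro s' a' r
      have h1 := congrArg (fun ρ => ∫⁻ u, F (fun _ => (s, a, r), u) ∂ρ)
        (map_zero_rolloutLaw M pol s' a')
      simp only at h1
      rw [lintegral_map (by fun_prop) (by fun_prop), lintegral_map (by fun_prop) (by fun_prop)]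
        at h1
      exact h1
    have e2 : ∀ s' a' r, ∫⁻ ξ, ∫⁻ y, F (fun _ => (s, a, r), y)
        ∂(chainKernel M pol (Trajectory.consTraj ((s, a, r), ξ) 0)) ∂(rolloutLaw M pol s' a') =
        ∑ s' : S, ∑ a' : A, (M.P s a s' * pol s' a') *
          ∫⁻ r', F (fun _ => (s, a, r), (s', a', r')) ∂(M.R s' a' : Measure ℝ) := by
      intro s' a' r
      change ∫⁻ ξ, ∫⁻ y, F (fun _ => (s, a, r), y) ∂(stepLaw M pol (s, a))
        ∂(rolloutLaw M pol s' a') = _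
      rw [lintegral_const, measure_univ, mul_one, lintegral_stepLaw M pol _ (by fun_prop)]
    simp only [e, e2]
    simp only [← Finset.sum_mul, sum_pmf_mul_pmf, one_mul]
    have hmeas : ∀ s' a', Measurable fun r =>
        ∫⁻ r', F (fun _ => (s, a, r), (s', a', r')) ∂(M.R s' a' : Measure ℝ) := by
      intro s' a'
      exact Measurable.lintegral_prod_right'
        (f := fun u : ℝ × ℝ => F (fun _ => (s, a, u.1), (s', a', u.2))) (by fun_prop)
    rw [lintegral_finsetSum _ fun s' _ => Finset.measurable_sum _ fun a' _ =>
      (hmeas s' a').const_mul _]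
    refine Finset.sum_congr rfl fun s' _ => ?_
    rw [lintegral_finsetSum _ fun a' _ => (hmeas s' a').const_mul _]
    refine Finset.sum_congr rfl fun a' _ => ?_
    rw [lintegral_const_mul _ (hmeas s' a')]
  | succ n =>
    refine Finset.sum_congr rfl fun s' _ => Finset.sum_congr rfl fun a' _ => ?_
    congr 1
    refine lintegral_congr fun r => ?_
    simp only [Trajectory.history_consTraj]
    exact isMarkovTraj_rolloutLaw M pol s' a' n
      (fun u => F (Trajectory.consHistory n (s, a, r) u.1, u.2)) (by fun_prop)

theorem map_zero_restartLaw (s : S) (a : A) :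
    (restartLaw M pol s a).map (fun ξ => ξ 0) =
      (M.R s a : Measure ℝ).map (fun r => (s, a, r)) := by
  refine Measure.ext_of_lintegral _ fun f hf => ?_
  rw [lintegral_map hf (by fun_prop), lintegral_map hf (by fun_prop),
    lintegral_restartLaw M pol s a (by fun_prop)]
  simp [Trajectory.consTraj, ← Finset.sum_mul, sum_pmf_mul_pmf]

/-- First-step decomposition, from uniqueness of Markov measures with given initial law; it is the
source of the Bellman equation. -/
theorem restartLaw_eq_rolloutLaw (s : S) (a : A) :
    restartLaw M pol s a = rolloutLaw M pol s a :=
  (isMarkovTraj_restartLaw M pol s a).ext (isMarkovTraj_rolloutLaw M pol s a)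
    (by rw [map_zero_restartLaw, map_zero_rolloutLaw])

theorem ae_reward_mem (s : S) (a : A) :
    ∀ᵐ ξ ∂(rolloutLaw M pol s a), ∀ t, (ξ t).2.2 ∈ Icc M.Rmin M.Rmax := by
  obtain ⟨g, hg, hg0⟩ : ∃ g : S × A × ℝ → ℝ≥0∞, Measurable g ∧
      ∀ u, g u = 0 ↔ u.2.2 ∈ Icc M.Rmin M.Rmax := by
    refine ⟨{u | u.2.2 ∉ Icc M.Rmin M.Rmax}.indicator 1, measurable_one.indicator
      ((measurable_snd.comp measurable_snd) measurableSet_Icc).compl, fun u => ?_⟩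
    by_cases h : u.2.2 ∈ Icc M.Rmin M.Rmax <;> simp [indicator, h, -mem_Icc]
  have hR : ∀ s a, ∫⁻ r, g (s, a, r) ∂(M.R s a : Measure ℝ) = 0 := by
    intro s a
    refine (lintegral_eq_zero_iff (by fun_prop)).2 ?_
    filter_upwards [M.reward_mem s a] with r hr
    exact (hg0 _).2 hr
  rw [ae_all_iff]
  intro t
  have h0 : ∫⁻ ξ, g (ξ t) ∂(rolloutLaw M pol s a) = 0 := by
    cases t with
    | zero =>
      have h1 : ∫⁻ u, g u ∂((rolloutLaw M pol s a).map fun ξ => ξ 0) =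
          ∫⁻ u, g u ∂((M.R s a : Measure ℝ).map fun r => (s, a, r)) := by
        rw [map_zero_rolloutLaw]
      rw [lintegral_map hg (by fun_prop), lintegral_map hg (by fun_prop)] at h1
      rw [h1, hR]
    | succ n =>
      rw [isMarkovTraj_rolloutLaw M pol s a n (fun u => g u.2) (by fun_prop)]
      simp only [chainKernel_apply, lintegral_stepLaw M pol _ hg, hR]
      simp
  rw [lintegral_eq_zero_iff (by fun_prop)] at h0
  filter_upwards [h0] with ξ hξ
  exact (hg0 _).1 hξ

omit [Fintype S] [Fintype A] [MeasurableSpace S] [MeasurableSpace A]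
  [MeasurableSingletonClass S] [MeasurableSingletonClass A] in
theorem discountedReturn_mem {ξ : ℕ → S × A × ℝ} (hξ : ∀ t, (ξ t).2.2 ∈ Icc M.Rmin M.Rmax) :
    Summable (fun t => M.γ ^ t * (ξ t).2.2) ∧ discountedReturn M ξ ∈ Icc M.Vmin M.Vmax := by
  have hγ := M.γ_pos
  have hg := summable_geometric_of_lt_one hγ.le M.γ_lt_one
  have hs : Summable (fun t => M.γ ^ t * (ξ t).2.2) := by
    refine Summable.of_norm_bounded (hg.mul_right (max |M.Rmin| |M.Rmax|)) fun t => ?_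
    rw [Real.norm_eq_abs, abs_mul, abs_of_nonneg (pow_nonneg hγ.le t)]
    exact mul_le_mul_of_nonneg_left (abs_le_max_abs_abs (hξ t).1 (hξ t).2) (pow_nonneg hγ.le t)
  have hc : ∀ c : ℝ, ∑' t, M.γ ^ t * c = c / (1 - M.γ) := fun c => by
    rw [tsum_mul_right, tsum_geometric_of_lt_one hγ.le M.γ_lt_one]; ring
  refine ⟨hs, ?_, ?_⟩
  · rw [Vmin, ← hc]
    exact (hg.mul_right _).tsum_le_tsum
      (fun t => mul_le_mul_of_nonneg_left (hξ t).1 (pow_nonneg hγ.le t)) hs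
  · rw [Vmax, ← hc]
    exact hs.tsum_le_tsum
      (fun t => mul_le_mul_of_nonneg_left (hξ t).2 (pow_nonneg hγ.le t)) (hg.mul_right _)

/-- Only almost-everywhere measurability is sought: almost surely rewards are bounded, the series
converges, and the return is a limit of measurable partial sums. -/
theorem aemeasurable_discountedReturn (s : S) (a : A) :
    AEMeasurable (discountedReturn M) (rolloutLaw M pol s a) := by
  refine aemeasurable_of_tendsto_metrizable_ae Filter.atTop
    (f := fun n ξ => ∑ t ∈ Finset.range n, M.γ ^ t * (ξ t).2.2)
    (fun n => Measurable.aemeasurable (by fun_prop)) ?_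
  filter_upwards [ae_reward_mem M pol s a] with ξ hξ
  exact (discountedReturn_mem M hξ).1.hasSum.tendsto_sum_nat

omit [Fintype S] [Fintype A] [MeasurableSpace S] [MeasurableSpace A]
  [MeasurableSingletonClass S] [MeasurableSingletonClass A] in
theorem discountedReturn_consTraj {ξ : ℕ → S × A × ℝ}
    (hξ : ∀ t, (ξ t).2.2 ∈ Icc M.Rmin M.Rmax) (u : S × A × ℝ) :
    discountedReturn M (Trajectory.consTraj (u, ξ)) = u.2.2 + M.γ * discountedReturn M ξ := by
  have hs := (discountedReturn_mem M hξ).1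
  unfold discountedReturn
  rw [Summable.tsum_eq_zero_add]
  · simp only [Trajectory.consTraj, pow_zero, one_mul, pow_succ', mul_assoc]
    rw [hs.tsum_mul_left]
    rfl
  · rw [← summable_nat_add_iff 1]
    simp only [Trajectory.consTraj, pow_succ', mul_assoc]
    exact hs.mul_left _

instance (s : S) (a : A) : IsProbabilityMeasure (returnLaw M pol s a) :=
  Measure.isProbabilityMeasure_map (aemeasurable_discountedReturn M pol s a)

theorem ae_mem_returnLaw (s : S) (a : A) :
    ∀ᵐ z ∂(returnLaw M pol s a), z ∈ Icc M.Vmin M.Vmax := by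
  refine (ae_map_iff (aemeasurable_discountedReturn M pol s a)
    (p := fun z => z ∈ Icc M.Vmin M.Vmax) measurableSet_Icc).2 ?_
  filter_upwards [ae_reward_mem M pol s a] with ξ hξ
  exact (discountedReturn_mem M hξ).2

theorem qFunction_eq (s : S) (a : A) :
    qFunction M pol s a = ∫ z, z ∂(returnLaw M pol s a) := by
  rw [returnLaw, integral_map (aemeasurable_discountedReturn M pol s a) (by fun_prop)]
  rfl

/-- The distributional Bellman equation for the return distributions. -/
theorem bellmanOp_returnLaw (s : S) (a : A) :
    bellmanOp M.γ (fun s a s' => M.P s a s') (fun s a => M.R s a) pol (returnLaw M pol) s a =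
      returnLaw M pol s a := by
  refine Measure.ext_of_lintegral _ fun f hf => ?_
  -- A genuinely measurable version of the return, set to zero off the trajectories with bounded
  -- rewards, so that it can be composed with prepending and integrated by Tonelli.
  obtain ⟨G, hG, hGe⟩ : ∃ G : (ℕ → S × A × ℝ) → ℝ, Measurable G ∧
      ∀ ξ : ℕ → S × A × ℝ, (∀ t, (ξ t).2.2 ∈ Icc M.Rmin M.Rmax) → G ξ = discountedReturn M ξ := by
    have hm : MeasurableSet {ξ : ℕ → S × A × ℝ | ∀ t, (ξ t).2.2 ∈ Icc M.Rmin M.Rmax} := by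
      rw [ofPred_forall]
      exact MeasurableSet.iInter fun t =>
        (measurable_snd.comp (measurable_snd.comp (measurable_pi_apply t))) measurableSet_Icc
    refine ⟨{ξ | ∀ t, (ξ t).2.2 ∈ Icc M.Rmin M.Rmax}.indicator (discountedReturn M), ?_,
      fun ξ hξ => indicator_of_mem (mem_ofPred.2 hξ) _⟩
    refine measurable_of_tendsto_metrizable
      (f := fun n => {ξ | ∀ t, (ξ t).2.2 ∈ Icc M.Rmin M.Rmax}.indicator
        fun ξ => ∑ t ∈ Finset.range n, M.γ ^ t * (ξ t).2.2)
      (fun n => Measurable.indicator (by fun_prop) hm) ?_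
    rw [tendsto_pi_nhds]
    intro ξ
    by_cases hξ : ξ ∈ {ξ : ℕ → S × A × ℝ | ∀ t, (ξ t).2.2 ∈ Icc M.Rmin M.Rmax}
    · simp only [indicator_of_mem hξ]
      exact (discountedReturn_mem M (mem_ofPred.1 hξ)).1.hasSum.tendsto_sum_nat
    · simp only [indicator_of_notMem hξ]
      exact tendsto_const_nhds
  have hlaw : ∀ s a, ∀ f : ℝ → ℝ≥0∞, Measurable f →
      ∫⁻ z, f z ∂(returnLaw M pol s a) = ∫⁻ ξ, f (G ξ) ∂(rolloutLaw M pol s a) := by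
    intro s a f hf
    rw [returnLaw, lintegral_map' hf.aemeasurable (aemeasurable_discountedReturn M pol s a)]
    refine lintegral_congr_ae ?_
    filter_upwards [ae_reward_mem M pol s a] with ξ hξ
    rw [hGe ξ hξ]
  rw [hlaw s a f hf, ← restartLaw_eq_rolloutLaw, lintegral_restartLaw M pol s a (by fun_prop)]
  simp only [bellmanOp, lintegral_finsetSum_measure, lintegral_smul_measure, smul_eq_mul]
  refine Finset.sum_congr rfl fun s' _ => Finset.sum_congr rfl fun a' _ => ?_
  rw [lintegral_map hf (by fun_prop), lintegral_prod _ (by fun_prop)]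
  congr 1
  refine lintegral_congr_ae ?_
  filter_upwards [M.reward_mem s a] with r hr
  rw [hlaw s' a' _ (by fun_prop)]
  refine lintegral_congr_ae ?_
  filter_upwards [ae_reward_mem M pol s' a'] with ξ hξ
  have hc : ∀ t, (Trajectory.consTraj ((s, a, r), ξ) t).2.2 ∈ Icc M.Rmin M.Rmax := by
    intro t
    cases t with
    | zero => exact hr
    | succ n => exact hξ n
  rw [hGe _ hc, hGe _ hξ, discountedReturn_consTraj M hξ]

end MDP

end Rollout

/-! ### Comparison principle for shifted Bellman operators -/

section Comparison

theorem measurable_measure_Iic (μ : Measure ℝ) : Measurable fun y => μ (Iic y) :=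
  Monotone.measurable fun _ _ h => measure_mono (Iic_subset_Iic.2 h)

theorem ext_of_measure_Iic {μ ν : Measure ℝ} [IsProbabilityMeasure μ] [IsProbabilityMeasure ν]
    (h : ∀ y, μ (Iic y) = ν (Iic y)) : μ = ν :=
  Measure.ext_of_Iic μ ν h

/-- The only source of contraction: rescaling the argument of a CDF by the discount multiplies areas
by `γ`, whatever the reward and the shift. -/
theorem lintegral_comp_affine {γ : ℝ} (hγ : 0 < γ) (d : ℝ) {f : ℝ → ℝ≥0∞} (hf : Measurable f) :
    ∫⁻ y, f ((y - d) / γ) = ENNReal.ofReal γ * ∫⁻ y, f y := by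
  rw [lintegral_sub_right_eq_self (fun y => f (y / γ)) d]
  have h := Real.map_volume_mul_right (inv_ne_zero hγ.ne')
  have : ∫⁻ y, f (y * γ⁻¹) = ∫⁻ y, f y ∂(Measure.map (· * γ⁻¹) volume) :=
    (lintegral_map hf (by fun_prop)).symm
  simp only [div_eq_mul_inv, this, h, lintegral_smul_measure, inv_inv, abs_of_pos hγ, smul_eq_mul]

/-- The positive part of the difference of two CDFs is integrable. -/
theorem lintegral_measure_Iic_sub_lt_top {μ ν : Measure ℝ} [IsProbabilityMeasure μ]
    [IsProbabilityMeasure ν] (hμ : Integrable (fun z => z) μ) (hν : Integrable (fun z => z) ν) :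
    ∫⁻ y, (μ (Iic y) - ν (Iic y)) < ∞ := by
  have hms : MeasurableSet {w : ℝ × ℝ × ℝ | w.2.1 ≤ w.1 ∧ w.1 < w.2.2} := by
    rw [ofPred_and]
    exact (measurableSet_le (by fun_prop) (by fun_prop)).inter
      (measurableSet_lt (by fun_prop) (by fun_prop))
  -- Under the product measure, the CDF difference at `y` is at most the probability that `u.1 ≤ y <
  -- u.2`. By Tonelli its integral is at most the mean of the positive part of `u.2 - u.1`.
  have h1 : ∀ y, μ (Iic y) - ν (Iic y) ≤ ∫⁻ u,
      {w : ℝ × ℝ × ℝ | w.2.1 ≤ w.1 ∧ w.1 < w.2.2}.indicator 1 (y, u) ∂(μ.prod ν) := by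
    intro y
    have hs : MeasurableSet {u : ℝ × ℝ | u.1 ≤ y ∧ y < u.2} := by
      rw [show {u : ℝ × ℝ | u.1 ≤ y ∧ y < u.2} = Iic y ×ˢ Ioi y by ext; simp]
      exact measurableSet_Iic.prod measurableSet_Ioi
    have e : ∫⁻ u, {w : ℝ × ℝ × ℝ | w.2.1 ≤ w.1 ∧ w.1 < w.2.2}.indicator 1 (y, u) ∂(μ.prod ν) =
        (μ.prod ν) {u : ℝ × ℝ | u.1 ≤ y ∧ y < u.2} := by
      rw [← lintegral_indicator_one hs]
      rfl
    rw [e, tsub_le_iff_right]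
    calc μ (Iic y) = (μ.prod ν) (Iic y ×ˢ univ) := by simp
      _ ≤ (μ.prod ν) ({u : ℝ × ℝ | u.1 ≤ y ∧ y < u.2} ∪ univ ×ˢ Iic y) := by
          refine measure_mono fun u hu => ?_
          simp only [mem_prod, mem_Iic, mem_univ, and_true, mem_union, mem_ofPred, true_and]
            at hu ⊢
          by_cases h : u.2 ≤ y
          · exact Or.inr h
          · exact Or.inl ⟨hu, not_le.1 h⟩
      _ ≤ _ := (measure_union_le _ _).trans (by simp)
  have h2 : ∀ u : ℝ × ℝ, ∫⁻ y,
      {w : ℝ × ℝ × ℝ | w.2.1 ≤ w.1 ∧ w.1 < w.2.2}.indicator 1 (y, u) ≤ ‖u.1‖ₑ + ‖u.2‖ₑ := by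
    intro u
    have e : ∫⁻ y, {w : ℝ × ℝ × ℝ | w.2.1 ≤ w.1 ∧ w.1 < w.2.2}.indicator 1 (y, u) =
        volume (Ico u.1 u.2) := by
      rw [← lintegral_indicator_one measurableSet_Ico]
      rfl
    rw [e, Real.volume_Ico, ← ofReal_norm, ← ofReal_norm,
      ← ENNReal.ofReal_add (norm_nonneg _) (norm_nonneg _)]
    refine ENNReal.ofReal_le_ofReal ?_
    have := neg_le_abs u.1
    have := le_abs_self u.2
    simp only [Real.norm_eq_abs]
    linarith
  calc ∫⁻ y, (μ (Iic y) - ν (Iic y))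
      ≤ ∫⁻ y, ∫⁻ u, {w : ℝ × ℝ × ℝ | w.2.1 ≤ w.1 ∧ w.1 < w.2.2}.indicator 1 (y, u)
          ∂(μ.prod ν) := lintegral_mono h1
    _ = ∫⁻ u, ∫⁻ y, {w : ℝ × ℝ × ℝ | w.2.1 ≤ w.1 ∧ w.1 < w.2.2}.indicator 1 (y, u)
          ∂volume ∂(μ.prod ν) :=
        lintegral_lintegral_swap ((measurable_one.indicator hms).aemeasurable)
    _ ≤ ∫⁻ u, (‖u.1‖ₑ + ‖u.2‖ₑ) ∂(μ.prod ν) := lintegral_mono h2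
    _ = ∫⁻ z, ‖z‖ₑ ∂μ + ∫⁻ z, ‖z‖ₑ ∂ν := by
        rw [lintegral_add_left (by fun_prop), lintegral_prod _ (by fun_prop),
          lintegral_prod _ (by fun_prop)]
        simp
    _ < ∞ := ENNReal.add_lt_top.2 ⟨hμ.2, hν.2⟩

variable {S A : Type*} [Fintype S] [Fintype A] {γ : ℝ} {P : S → A → S → ℝ≥0∞}
  {R : S → A → Measure ℝ} {pol : S → PMF A} {c : S → A → ℝ}

/-- The CDF of a shifted Bellman update. -/
theorem shiftOp_bellmanOp_Iic (hγ : 0 < γ) {Z : S → A → Measure ℝ} {s : S} {a : A}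
    [SFinite (R s a)] (hZ : ∀ s' a', P s a s' ≠ 0 → IsProbabilityMeasure (Z s' a')) (y : ℝ) :
    shiftOp c (bellmanOp γ P R pol Z) s a (Iic y) = ∑ s' : S, ∑ a' : A, (P s a s' * pol s' a') *
      ∫⁻ r, Z s' a' (Iic ((y - (r - c s a)) / γ)) ∂(R s a) := by
  rw [shiftOp, Measure.map_apply (by fun_prop) measurableSet_Iic, bellmanOp]
  simp only [Measure.finsetSum_apply, Measure.smul_apply, smul_eq_mul]
  refine Finset.sum_congr rfl fun s' _ => Finset.sum_congr rfl fun a' _ => ?_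
  by_cases h0 : P s a s' = 0
  · simp [h0]
  have := hZ s' a' h0
  have hm : MeasurableSet ((fun z => z - c s a) ⁻¹' Iic y) := by measurability
  rw [Measure.map_apply (by fun_prop) hm,
    Measure.prod_apply ((by fun_prop : Measurable fun u : ℝ × ℝ => u.1 + γ * u.2) hm)]
  congr 1
  refine lintegral_congr fun r => ?_
  congr 1
  ext z
  simp only [mem_preimage, mem_Iic]
  rw [le_div_iff₀ hγ]
  constructor <;> intro h <;> linarith

/-- Comparison principle: a sub-solution of a shifted Bellman equation has a CDF bounded by that
of a super-solution, on any set of states closed under the transitions. -/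
theorem measure_Iic_le_of_bellmanOp (hγ : 0 < γ) (hγ1 : γ < 1) {D : Set S}
    [∀ s a, SFinite (R s a)]
    (hP : ∀ s ∈ D, ∀ a, ∑ s' : S, ∑ a' : A, P s a s' * pol s' a' ≤ 1)
    (hR : ∀ s ∈ D, ∀ a, IsProbabilityMeasure (R s a))
    (hD : ∀ s ∈ D, ∀ a s', P s a s' ≠ 0 → s' ∈ D) {U V : S → A → Measure ℝ}
    (hU : ∀ s ∈ D, ∀ a, IsProbabilityMeasure (U s a))
    (hV : ∀ s ∈ D, ∀ a, IsProbabilityMeasure (V s a))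
    (hUi : ∀ s ∈ D, ∀ a, Integrable (fun z => z) (U s a))
    (hVi : ∀ s ∈ D, ∀ a, Integrable (fun z => z) (V s a))
    (hUT : ∀ s ∈ D, ∀ a, ∀ y, U s a (Iic y) ≤ shiftOp c (bellmanOp γ P R pol U) s a (Iic y))
    (hVT : ∀ s ∈ D, ∀ a, ∀ y, shiftOp c (bellmanOp γ P R pol V) s a (Iic y) ≤ V s a (Iic y)) :
    ∀ s ∈ D, ∀ a, ∀ y, U s a (Iic y) ≤ V s a (Iic y) := by
  classical
  have hmd : ∀ s a, Measurable fun y => U s a (Iic y) - V s a (Iic y) := fun s a =>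
    (measurable_measure_Iic _).sub (measurable_measure_Iic _)
  set d : S → A → ℝ≥0∞ := fun s a => ∫⁻ y, (U s a (Iic y) - V s a (Iic y)) with hd
  set m : ℝ≥0∞ := Finset.univ.sup fun q : S × A => if q.1 ∈ D then d q.1 q.2 else 0 with hm
  have hdm : ∀ s ∈ D, ∀ a, d s a ≤ m := by
    intro s hs a
    have := Finset.le_sup (f := fun q : S × A => if q.1 ∈ D then d q.1 q.2 else 0)
      (Finset.mem_univ (s, a))
    simpa [hs] using this
  -- Finiteness is essential: `m ≤ γ m` says nothing about `m = ∞`.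
  have hmt : m < ∞ := by
    rw [hm, Finset.sup_lt_iff (by simp)]
    rintro ⟨s, a⟩ -
    by_cases hs : s ∈ D
    · have := hU s hs a
      have := hV s hs a
      simpa [hs] using lintegral_measure_Iic_sub_lt_top (hUi s hs a) (hVi s hs a)
    · simp [hs]
  have hdγ : ∀ s ∈ D, ∀ a, d s a ≤ ENNReal.ofReal γ * m := by
    intro s hs a
    have := hR s hs a
    have hmk : ∀ s' a', Measurable fun w : ℝ × ℝ =>
        U s' a' (Iic ((w.1 - (w.2 - c s a)) / γ)) - V s' a' (Iic ((w.1 - (w.2 - c s a)) / γ)) :=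
      fun s' a' => (hmd s' a').comp
        (by fun_prop : Measurable fun w : ℝ × ℝ => (w.1 - (w.2 - c s a)) / γ)
    -- Both families are updated with the same rewards, shift and transition weights, so the excess
    -- after an update is at most the average of the excesses before it.
    have hpt : ∀ y, U s a (Iic y) - V s a (Iic y) ≤ ∑ s' : S, ∑ a' : A, (P s a s' * pol s' a') *
        ∫⁻ r, (U s' a' (Iic ((y - (r - c s a)) / γ)) - V s' a' (Iic ((y - (r - c s a)) / γ)))
          ∂(R s a) := by
      intro y
      rw [tsub_le_iff_right]
      refine (hUT s hs a y).trans (le_trans ?_ (add_le_add le_rfl (hVT s hs a y)))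
      rw [shiftOp_bellmanOp_Iic hγ (fun s' a' h => hU s' (hD s hs a s' h) a'),
        shiftOp_bellmanOp_Iic hγ (fun s' a' h => hV s' (hD s hs a s' h) a')]
      simp only [← Finset.sum_add_distrib, ← mul_add]
      gcongr with s' _ a' _
      rw [← lintegral_add_right]
      · exact lintegral_mono fun r => le_tsub_add
      · exact (measurable_measure_Iic _).comp (by fun_prop)
    have hinner : ∀ s' a', ∫⁻ y, ∫⁻ r, (U s' a' (Iic ((y - (r - c s a)) / γ)) -
        V s' a' (Iic ((y - (r - c s a)) / γ))) ∂(R s a) = ENNReal.ofReal γ * d s' a' := by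
      intro s' a'
      rw [lintegral_lintegral_swap (hmk s' a').aemeasurable]
      simp only [lintegral_comp_affine hγ _ (hmd s' a')]
      simp [hd]
    have hmr : ∀ s' a', Measurable fun y => ∫⁻ r, (U s' a' (Iic ((y - (r - c s a)) / γ)) -
        V s' a' (Iic ((y - (r - c s a)) / γ))) ∂(R s a) := fun s' a' =>
      (hmk s' a').lintegral_prod_right'
    calc d s a ≤ ∫⁻ y, ∑ s' : S, ∑ a' : A, (P s a s' * pol s' a') *
        ∫⁻ r, (U s' a' (Iic ((y - (r - c s a)) / γ)) - V s' a' (Iic ((y - (r - c s a)) / γ)))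
          ∂(R s a) := lintegral_mono hpt
      _ = ∑ s' : S, ∑ a' : A, (P s a s' * pol s' a') * (ENNReal.ofReal γ * d s' a') := by
          rw [lintegral_finsetSum _ fun s' _ => Finset.measurable_sum _ fun a' _ =>
            (hmr s' a').const_mul _]
          refine Finset.sum_congr rfl fun s' _ => ?_
          rw [lintegral_finsetSum _ fun a' _ => (hmr s' a').const_mul _]
          refine Finset.sum_congr rfl fun a' _ => ?_
          rw [lintegral_const_mul _ (hmr s' a'), hinner]
      _ ≤ ∑ s' : S, ∑ a' : A, (P s a s' * pol s' a') * (ENNReal.ofReal γ * m) := by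
          refine Finset.sum_le_sum fun s' _ => Finset.sum_le_sum fun a' _ => ?_
          by_cases h0 : P s a s' = 0
          · simp [h0]
          · gcongr
            exact hdm s' (hD s hs a s' h0) a'
      _ ≤ ENNReal.ofReal γ * m := by
          simp only [← Finset.sum_mul]
          exact mul_le_of_le_one_left zero_le (hP s hs a)
  have hm0 : m = 0 := by
    by_contra h0
    have hle : m ≤ ENNReal.ofReal γ * m := by
      refine Finset.sup_le fun q _ => ?_
      split_ifs with h
      · exact hdγ _ h _
      · exact zero_le
    have : ENNReal.ofReal γ * m < 1 * m :=
      ENNReal.mul_lt_mul_left h0 hmt.ne (by simpa using hγ1)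
    rw [one_mul] at this
    exact absurd hle (not_le.2 this)
  intro s hs a y
  have := hU s hs a
  have := hV s hs a
  have hz : d s a = 0 := le_antisymm ((hdm s hs a).trans hm0.le) zero_le
  rw [hd, lintegral_eq_zero_iff (hmd s a)] at hz
  have hae : ∀ᵐ t, U s a (Iic t) ≤ V s a (Iic t) := by
    filter_upwards [hz] with t ht
    exact tsub_eq_zero_iff_le.1 ht
  -- A vanishing integral gives the inequality only almost everywhere. Good points are dense to the
  -- right of `y`, and right continuity of CDFs carries the inequality to `y`.
  have hden : ∀ n : ℕ, ∃ t ∈ Ioo y (y + 1 / (n + 1)), U s a (Iic t) ≤ V s a (Iic t) := by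
    intro n
    have hpos : (0 : ℝ) < 1 / (n + 1) := Nat.one_div_pos_of_nat
    have := (Real.volume_Ioo ▸ ENNReal.ofReal_pos.2 (by linarith) :
      0 < volume (Ioo y (y + 1 / (n + 1))))
    obtain ⟨t, ht, ht'⟩ := nonempty_of_measure_ne_zero
      (((measure_inter_conull (t := {t | U s a (Iic t) ≤ V s a (Iic t)}) (by
        simpa [ae_iff, compl_ofPred] using hae)).trans_ne this.ne'))
    exact ⟨t, ht, ht'⟩
  choose t ht hUV using hden
  have hlim : Filter.Tendsto t Filter.atTop (nhdsWithin y (Ici y)) := by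
    refine tendsto_nhdsWithin_iff.2 ⟨?_, .of_forall fun n => (ht n).1.le⟩
    refine tendsto_of_tendsto_of_tendsto_of_le_of_le tendsto_const_nhds (h := fun n : ℕ =>
      y + 1 / ((n : ℝ) + 1)) ?_ (fun n => (ht n).1.le) (fun n => (ht n).2.le)
    simpa using tendsto_one_div_add_atTop_nhds_zero_nat.const_add y
  have hc : ∀ μ : Measure ℝ, [IsProbabilityMeasure μ] →
      Filter.Tendsto (fun n => μ (Iic (t n))) Filter.atTop (nhds (μ (Iic y))) := by
    intro μ _
    simp only [← ofReal_cdf μ]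
    exact (ENNReal.continuous_ofReal.tendsto _).comp (((cdf μ).right_continuous y).tendsto.comp hlim)
  exact le_of_tendsto_of_tendsto' (hc (U s a)) (hc (V s a)) hUV

end Comparison

theorem lintegral_shiftOp_bellmanOp {S A : Type*} [Fintype S] [Fintype A] {γ : ℝ}
    {P : S → A → S → ℝ≥0∞} {R : S → A → Measure ℝ} {pol : S → PMF A} {c : S → A → ℝ}
    {Z : S → A → Measure ℝ} [∀ s a, SFinite (Z s a)] {s : S} {a : A} [SFinite (R s a)]
    {f : ℝ → ℝ≥0∞} (hf : Measurable f) :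
    ∫⁻ z, f z ∂(shiftOp c (bellmanOp γ P R pol Z) s a) =
      ∑ s' : S, ∑ a' : A, (P s a s' * pol s' a') *
        ∫⁻ r, ∫⁻ z, f (r + γ * z - c s a) ∂(Z s' a') ∂(R s a) := by
  rw [shiftOp, lintegral_map hf (by fun_prop), bellmanOp]
  simp only [lintegral_finsetSum_measure, lintegral_smul_measure, smul_eq_mul]
  refine Finset.sum_congr rfl fun s' _ => Finset.sum_congr rfl fun a' _ => ?_
  rw [lintegral_map (by fun_prop) (by fun_prop), lintegral_prod _ (by fun_prop)]

theorem integrable_id_of_integrable_abs_rpow {μ : Measure ℝ} [IsFiniteMeasure μ] {p : ℝ}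
    (hp : 1 ≤ p) (h : Integrable (fun z => |z| ^ p) μ) : Integrable (fun z => z) μ := by
  refine ((integrable_const (1 : ℝ)).add h).mono' (by fun_prop) (.of_forall fun z => ?_)
  simp only [Real.norm_eq_abs, Pi.add_apply]
  have h0 := Real.rpow_nonneg (abs_nonneg z) p
  rcases le_total |z| 1 with hz | hz
  · linarith
  · have := Real.rpow_le_rpow_of_exponent_le hz hp
    rw [Real.rpow_one] at this
    linarith

/-! ### Empirical distributions under coverage -/

section Dataset

variable {S A : Type*} [DecidableEq S] [DecidableEq A] {N : ℕ} {x : Fin N → S × A}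
  {ω : Fin N → ℝ × S}

theorem Covers.visits_pos (h : Covers x ω) {s : S} (hs : s ∈ dataStates x ω) (a : A) :
    0 < visits x s a := by
  have := h s hs a
  by_contra h0
  simp [behaviorPolicy, Nat.eq_zero_of_not_pos h0] at this

/-- Empirical transitions never leave the states of the dataset; this is the closedness that the
comparison principle asks for. -/
theorem mem_dataStates_of_empiricalP_ne_zero {s : S} {a : A} {s' : S}
    (h : empiricalP x ω s a s' ≠ 0) : s' ∈ dataStates x ω := by
  have h0 : (Finset.univ.filter fun i => x i = (s, a) ∧ (ω i).2 = s').card ≠ 0 := by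
    intro h0
    simp [empiricalP, h0] at h
  obtain ⟨i, hi⟩ := Finset.card_ne_zero.1 h0
  exact ⟨i, Or.inr (Finset.mem_filter.1 hi).2.2⟩

theorem sum_empiricalP [Fintype S] {s : S} {a : A} (h : 0 < visits x s a) :
    ∑ s' : S, empiricalP x ω s a s' = 1 := by
  have hc : ∑ s' : S, (Finset.univ.filter fun i => x i = (s, a) ∧ (ω i).2 = s').card =
      visits x s a := by
    rw [visits, Finset.card_eq_sum_card_fiberwise (f := fun i => (ω i).2) (t := Finset.univ)
      (fun _ _ => Finset.mem_coe.2 (Finset.mem_univ _))]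
    simp only [Finset.filter_filter]
  simp only [empiricalP, div_eq_mul_inv, ← Finset.sum_mul]
  rw [← Nat.cast_sum, hc]
  exact ENNReal.mul_inv_cancel (by exact_mod_cast h.ne') (ENNReal.natCast_ne_top _)

theorem sum_empiricalP_mul_pmf [Fintype S] [Fintype A] (pol : S → PMF A) {s : S} {a : A}
    (h : 0 < visits x s a) :
    ∑ s' : S, ∑ a' : A, empiricalP x ω s a s' * pol s' a' = 1 := by
  have hA : ∀ s', ∑ a' : A, pol s' a' = 1 := fun s' => by
    rw [← tsum_fintype (L := .unconditional _)]; exact (pol s').tsum_coe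
  simp [← Finset.mul_sum, hA, sum_empiricalP h]

theorem isProbabilityMeasure_empiricalR {s : S} {a : A} (h : 0 < visits x s a) :
    IsProbabilityMeasure (empiricalR x ω s a) := by
  constructor
  simp only [empiricalR, Measure.smul_apply, Measure.finsetSum_apply, measure_univ, smul_eq_mul,
    Finset.sum_const, nsmul_eq_mul, mul_one]
  exact ENNReal.inv_mul_cancel (by exact_mod_cast h.ne') (ENNReal.natCast_ne_top _)

instance (s : S) (a : A) : SFinite (empiricalR x ω s a) := by
  unfold empiricalR; infer_instance

/-- A statement holds almost surely for the empirical rewards if it holds for the data. -/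
theorem ae_empiricalR {s : S} {a : A} {q : ℝ → Prop} (h : ∀ i, x i = (s, a) → q (ω i).1) :
    ∀ᵐ r ∂(empiricalR x ω s a), q r := by
  refine Measure.ae_smul_measure ?_ _
  rw [ae_finsetSum_measure_iff]
  intro i hi
  rw [ae_dirac_eq]
  exact h i (Finset.mem_filter.1 hi).2

end Dataset

/-! ### Existence and uniqueness of the fixed point -/

section Existence

variable {S A : Type*} [Fintype S] [Fintype A] [DecidableEq S] [DecidableEq A]
  (M : MDP S A) (pol : S → PMF A) {N : ℕ} (x : Fin N → S × A) (ω : Fin N → ℝ × S)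
  (c : S → A → ℝ)

/-- The empirical reward distributions lowered by `c`, with value `0` at unvisited pairs. -/
noncomputable def loweredReward (s : S) (a : A) : ProbabilityMeasure ℝ :=
  ⟨if 0 < visits x s a then (empiricalR x ω s a).map (fun r => r - c s a) else Measure.dirac 0, by
    split_ifs with h
    · have := isProbabilityMeasure_empiricalR (ω := ω) h
      exact Measure.isProbabilityMeasure_map (by fun_prop)
    · infer_instance⟩

/-- The empirical Markov decision process of a dataset, with rewards lowered by `c`. -/
noncomputable def MDP.empirical : MDP S A where
  -- Unvisited pairs get a dummy self-loop. Its form is irrelevant, since the fixed-point equation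
  -- is only used at visited pairs.
  P s a := if h : 0 < visits x s a then
    PMF.ofFintype (empiricalP x ω s a) (sum_empiricalP h) else PMF.pure s
  R := loweredReward x ω c
  γ := M.γ
  γ_pos := M.γ_pos
  γ_lt_one := M.γ_lt_one
  Rmin := -(∑ i, |(ω i).1| + ∑ s, ∑ a, |c s a|)
  Rmax := ∑ i, |(ω i).1| + ∑ s, ∑ a, |c s a|
  reward_mem s a := by
    simp only [← abs_le, mem_Icc, loweredReward, ProbabilityMeasure.coe_mk]
    by_cases h : 0 < visits x s a
    · rw [if_pos h]
      refine (ae_map_iff (measurable_id.sub_const (c s a)).aemeasurable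
        (p := fun r => |r| ≤ ∑ i, |(ω i).1| + ∑ s, ∑ a, |c s a|)
        (isClosed_le continuous_abs continuous_const).measurableSet).2 (ae_empiricalR fun i _ => ?_)
      refine (abs_sub _ _).trans (add_le_add ?_ ?_)
      · exact Finset.single_le_sum (f := fun i => |(ω i).1|) (fun _ _ => abs_nonneg _)
          (Finset.mem_univ i)
      · exact (Finset.single_le_sum (f := fun a => |c s a|) (fun _ _ => abs_nonneg _)
          (Finset.mem_univ a)).trans (Finset.single_le_sum (f := fun s => ∑ a, |c s a|)
            (fun _ _ => Finset.sum_nonneg fun _ _ => abs_nonneg _) (Finset.mem_univ s))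
    · rw [if_neg h]
      change ∀ᵐ r ∂(Measure.dirac (0 : ℝ)), |r| ≤ ∑ i, |(ω i).1| + ∑ s, ∑ a, |c s a|
      rw [ae_dirac_eq]
      change |(0 : ℝ)| ≤ _
      rw [abs_zero]
      positivity

variable [MeasurableSpace S] [MeasurableSpace A] [MeasurableSingletonClass S]
  [MeasurableSingletonClass A] {x ω}

/-- Lowering `r + γ z` by `c` is the same as lowering `r`, so the shift is absorbed into the reward
and the equation becomes an ordinary Bellman equation. -/
theorem MDP.shiftOp_empiricalBellmanOp_returnLaw {s : S} {a : A} (h : 0 < visits x s a) :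
    shiftOp c (empiricalBellmanOp M pol x ω (returnLaw (M.empirical x ω c) pol)) s a =
      returnLaw (M.empirical x ω c) pol s a := by
  have := isProbabilityMeasure_empiricalR (ω := ω) h
  rw [← MDP.bellmanOp_returnLaw (M.empirical x ω c) pol s a]
  refine Measure.ext_of_lintegral _ fun f hf => ?_
  rw [empiricalBellmanOp, lintegral_shiftOp_bellmanOp hf, bellmanOp]
  simp only [lintegral_finsetSum_measure, lintegral_smul_measure, smul_eq_mul]
  refine Finset.sum_congr rfl fun s' _ => Finset.sum_congr rfl fun a' _ => ?_
  rw [lintegral_map hf (by fun_prop), lintegral_prod _ (by fun_prop)]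
  have hP : (M.empirical x ω c).P s a s' = empiricalP x ω s a s' := by
    simp [MDP.empirical, h]
  have hR : ((M.empirical x ω c).R s a : Measure ℝ) =
      (empiricalR x ω s a).map (fun r => r - c s a) := by
    simp [MDP.empirical, loweredReward, h]
  have hg : (M.empirical x ω c).γ = M.γ := rfl
  rw [hP, hR, hg, lintegral_map _ (by fun_prop)]
  · simp only [sub_add_eq_add_sub]
  · exact Measurable.lintegral_prod_right' (f := fun u : ℝ × ℝ => f (u.1 + M.γ * u.2))
      (by fun_prop)

theorem MDP.ae_abs_returnLaw_empirical (s : S) (a : A) :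
    ∀ᵐ z ∂(returnLaw (M.empirical x ω c) pol s a), |z| ≤ (M.empirical x ω c).Vmax := by
  filter_upwards [MDP.ae_mem_returnLaw (M.empirical x ω c) pol s a] with z hz
  have : (M.empirical x ω c).Vmin = -(M.empirical x ω c).Vmax := by
    exact neg_div _ _
  rw [this] at hz
  exact abs_le.2 hz

variable {p α : ℝ} {c₀ : S → A → ℝ} {M pol}

theorem isCDEFixedPoint_returnLaw_empirical (hp : 1 < p) (h : Covers x ω) :
    IsCDEFixedPoint M pol p α c₀ x ω
      (returnLaw (M.empirical x ω (penalty p α c₀)) pol) := by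
  intro s hs a
  refine ⟨inferInstance, ?_, M.shiftOp_empiricalBellmanOp_returnLaw pol _ (h.visits_pos hs a)⟩
  refine Integrable.of_bound (C := (M.empirical x ω (penalty p α c₀)).Vmax ^ p)
    ((Real.continuous_rpow_const (by linarith)).comp continuous_abs).aestronglyMeasurable ?_
  filter_upwards [M.ae_abs_returnLaw_empirical (x := x) (ω := ω) pol (penalty p α c₀) s a]
    with z hz
  rw [Real.norm_eq_abs, abs_of_nonneg (Real.rpow_nonneg (abs_nonneg z) p)]
  exact Real.rpow_le_rpow (abs_nonneg z) hz (by linarith)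

omit [MeasurableSpace S] [MeasurableSpace A] [MeasurableSingletonClass S]
  [MeasurableSingletonClass A] in
/-- Comparison of a family of distributions that improves under the operator with a fixed point. -/
theorem IsCDEFixedPoint.measure_Iic_le {Z U : S → A → Measure ℝ} (h : Covers x ω) (hp : 1 < p)
    (hZ : IsCDEFixedPoint M pol p α c₀ x ω Z)
    (hU : ∀ s ∈ dataStates x ω, ∀ a, IsProbabilityMeasure (U s a))
    (hUi : ∀ s ∈ dataStates x ω, ∀ a, Integrable (fun z => z) (U s a))
    (hUT : ∀ s ∈ dataStates x ω, ∀ a, ∀ y, U s a (Iic y) ≤ cdeOp M pol p α c₀ x ω U s a (Iic y)) :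
    ∀ s ∈ dataStates x ω, ∀ a, ∀ y, U s a (Iic y) ≤ Z s a (Iic y) := by
  refine measure_Iic_le_of_bellmanOp M.γ_pos M.γ_lt_one
    (fun s hs a => (sum_empiricalP_mul_pmf pol (h.visits_pos hs a)).le)
    (fun s hs a => isProbabilityMeasure_empiricalR (h.visits_pos hs a))
    (fun s hs a s' hs' => mem_dataStates_of_empiricalP_ne_zero hs') hU
    (fun s hs a => (hZ s hs a).1) hUi (fun s hs a => ?_) hUT
    (fun s hs a y => (congrArg (fun μ : Measure ℝ => μ (Iic y)) (hZ s hs a).2.2).le)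
  have := (hZ s hs a).1
  exact integrable_id_of_integrable_abs_rpow hp.le (hZ s hs a).2.1

omit [MeasurableSpace S] [MeasurableSpace A] [MeasurableSingletonClass S]
  [MeasurableSingletonClass A] in
-- A fixed point is both a sub-solution and a super-solution, so two of them dominate each other.
theorem IsCDEFixedPoint.unique {Z Z' : S → A → Measure ℝ} (h : Covers x ω) (hp : 1 < p)
    (hZ : IsCDEFixedPoint M pol p α c₀ x ω Z) (hZ' : IsCDEFixedPoint M pol p α c₀ x ω Z') :
    ∀ s ∈ dataStates x ω, ∀ a, Z' s a = Z s a := by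
  have key : ∀ Z Z' : S → A → Measure ℝ, IsCDEFixedPoint M pol p α c₀ x ω Z →
      IsCDEFixedPoint M pol p α c₀ x ω Z' →
      ∀ s ∈ dataStates x ω, ∀ a, ∀ y, Z' s a (Iic y) ≤ Z s a (Iic y) := by
    intro Z Z' hZ hZ'
    refine hZ.measure_Iic_le h hp (fun s hs a => (hZ' s hs a).1) (fun s hs a => ?_)
      (fun s hs a y => (congrArg (fun μ : Measure ℝ => μ (Iic y)) (hZ' s hs a).2.2).ge)
    have := (hZ' s hs a).1
    exact integrable_id_of_integrable_abs_rpow hp.le (hZ' s hs a).2.1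
  intro s hs a
  have := (hZ s hs a).1
  have := (hZ' s hs a).1
  exact ext_of_measure_Iic fun y =>
    le_antisymm (key Z Z' hZ hZ' s hs a y) (key Z' Z hZ' hZ s hs a y)

end Existence

/-! ### Maximal inequality for normalized indicators -/

section Maximal

variable {X : Type*} [MeasurableSpace X] {ι : Type*}

/-- The exponential weight of the normalized indicator of `B`, with `b` the probability of `B`. -/
noncomputable def expWeight (θ b : ℝ) (B : Set X) (v : X) : ℝ≥0∞ :=
  ENNReal.ofReal (Real.exp (θ * (B.indicator 1 v / b - 1)))

theorem measurable_expWeight (θ b : ℝ) {B : Set X} (hB : MeasurableSet B) :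
    Measurable (expWeight θ b B) := by
  have : Measurable (B.indicator (1 : X → ℝ)) := measurable_one.indicator hB
  unfold expWeight
  fun_prop

omit [MeasurableSpace X] in
theorem expWeight_of_mem {θ b : ℝ} {B : Set X} {v : X} (h : v ∈ B) :
    expWeight θ b B v = ENNReal.ofReal (Real.exp (θ * (1 / b - 1))) := by
  simp [expWeight, h]

omit [MeasurableSpace X] in
theorem expWeight_of_notMem {θ b : ℝ} {B : Set X} {v : X} (h : v ∉ B) :
    expWeight θ b B v = ENNReal.ofReal (Real.exp (-θ)) := by
  simp [expWeight, h]

/-- Passing to a smaller set increases the expected weight, even against a function that is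
constant on the larger set. -/
theorem lintegral_mul_expWeight_le (ν : Measure X) [IsProbabilityMeasure ν] (θ : ℝ) {b b' : ℝ}
    {B B' : Set X} (hB : MeasurableSet B) (hB' : MeasurableSet B') (hsub : B' ⊆ B)
    (hb : ν.real B = b) (hb' : ν.real B' = b') (hpos : 0 < b') {h : X → ℝ≥0∞}
    (hh : ∀ u ∈ B, ∀ v ∈ B, h u = h v) :
    ∫⁻ v, h v * expWeight θ b B v ∂ν ≤ ∫⁻ v, h v * expWeight θ b' B' v ∂ν := by
  have hbb : b' ≤ b := hb ▸ hb' ▸ measureReal_mono hsub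
  have hbpos : 0 < b := hpos.trans_le hbb
  obtain ⟨u, hu⟩ : B.Nonempty := by
    by_contra hne
    rw [not_nonempty_iff_eq_empty] at hne
    simp [hne] at hb
    linarith
  have hνB : ν B = ENNReal.ofReal b := by rw [← hb, ofReal_measureReal]
  have hνB' : ν B' = ENNReal.ofReal b' := by rw [← hb', ofReal_measureReal]
  have hνd : ν (B \ B') = ENNReal.ofReal (b - b') := by
    rw [measure_sdiff hsub hB'.nullMeasurableSet (measure_ne_top _ _), hνB, hνB',
      ENNReal.ofReal_sub _ hpos.le]
  rw [← lintegral_add_compl _ hB, ← lintegral_add_compl (fun v => h v * expWeight θ b' B' v) hB]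
  refine add_le_add ?_ (le_of_eq ?_)
  · have e1 : ∫⁻ v in B, h v * expWeight θ b B v ∂ν =
        h u * (ENNReal.ofReal (Real.exp (θ * (1 / b - 1))) * ENNReal.ofReal b) := by
      rw [setLIntegral_congr_fun (g := fun _ => h u * ENNReal.ofReal (Real.exp (θ * (1 / b - 1))))
        hB fun v hv => by simp only [hh v hv u hu, expWeight_of_mem hv]]
      rw [setLIntegral_const, hνB, mul_assoc]
    have e2 : ∫⁻ v in B, h v * expWeight θ b' B' v ∂ν =
        h u * (ENNReal.ofReal (Real.exp (θ * (1 / b' - 1))) * ENNReal.ofReal b' +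
          ENNReal.ofReal (Real.exp (-θ)) * ENNReal.ofReal (b - b')) := by
      conv_lhs => rw [← union_sdiff_cancel hsub]
      rw [lintegral_union (hB.diff hB') disjoint_sdiff_right]
      rw [setLIntegral_congr_fun (g := fun _ => h u * ENNReal.ofReal (Real.exp (θ * (1 / b' - 1))))
        hB' fun v hv => by simp only [hh v (hsub hv) u hu, expWeight_of_mem hv]]
      rw [setLIntegral_congr_fun (g := fun _ => h u * ENNReal.ofReal (Real.exp (-θ)))
        (hB.diff hB') fun v hv => by simp only [hh v hv.1 u hu, expWeight_of_notMem hv.2]]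
      rw [setLIntegral_const, setLIntegral_const, hνB', hνd]
      ring
    rw [e1, e2, ← ENNReal.ofReal_mul (Real.exp_pos _).le, ← ENNReal.ofReal_mul (Real.exp_pos _).le,
      ← ENNReal.ofReal_mul (Real.exp_pos _).le, ← ENNReal.ofReal_add (by positivity)
        (mul_nonneg (Real.exp_pos _).le (by linarith))]
    refine mul_le_mul_right (ENNReal.ofReal_le_ofReal ?_) _
    -- Two-point Jensen inequality. Inside `B`, the set `B'` has relative mass `b' / b`, and the
    -- corresponding average of `1 / b' - 1` and `-1` is `1 / b - 1`: this is the martingale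
    -- property of `1_B / b`.
    have hconv := convexOn_exp.2 (mem_univ (θ * (1 / b' - 1))) (mem_univ (-θ))
      (div_nonneg hpos.le hbpos.le) (div_nonneg (sub_nonneg.2 hbb) hbpos.le)
      (by field_simp; ring)
    have earg : (b' / b) • (θ * (1 / b' - 1)) + ((b - b') / b) • (-θ) = θ * (1 / b - 1) := by
      simp only [smul_eq_mul]
      field_simp
      ring
    rw [earg] at hconv
    simp only [smul_eq_mul] at hconv
    calc Real.exp (θ * (1 / b - 1)) * b
        ≤ (b' / b * Real.exp (θ * (1 / b' - 1)) + (b - b') / b * Real.exp (-θ)) * b :=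
          mul_le_mul_of_nonneg_right hconv hbpos.le
      _ = _ := by field_simp
  · refine setLIntegral_congr_fun hB.compl fun v hv => ?_
    simp only [expWeight_of_notMem hv, expWeight_of_notMem fun h' => hv (hsub h')]

/-- Hoeffding's lemma: the normalized indicator has mean one and takes values in `[0, 1 / b]`,
contained in `[0, 2]` because `b ≥ 1/2`, so its variance proxy is at most one. -/
theorem lintegral_expWeight_le (ν : Measure X) [IsProbabilityMeasure ν] (θ : ℝ) {b : ℝ}
    {B : Set X} (hB : MeasurableSet B) (hb : ν.real B = b) (hpos : 1 / 2 ≤ b) :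
    ∫⁻ v, expWeight θ b B v ∂ν ≤ ENNReal.ofReal (Real.exp (θ ^ 2 / 2)) := by
  have hbpos : 0 < b := by linarith
  have hmeas : Measurable fun v => B.indicator (1 : X → ℝ) v / b :=
    (measurable_one.indicator hB).div_const b
  have hmean : ∫ v, B.indicator (1 : X → ℝ) v / b ∂ν = 1 := by
    rw [integral_div, integral_indicator_one hB, hb, div_self hbpos.ne']
  have hsg := hasSubgaussianMGF_of_mem_Icc (μ := ν) (a := 0) (b := 1 / b) hmeas.aemeasurable
    (.of_forall fun v => by
      by_cases h : v ∈ B <;> simp [h, hbpos.le])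
  rw [hmean] at hsg
  unfold expWeight
  rw [← ofReal_integral_eq_lintegral_ofReal (hsg.integrable_exp_mul θ)
    (.of_forall fun _ => (Real.exp_pos _).le)]
  refine ENNReal.ofReal_le_ofReal ((hsg.mgf_le θ).trans (Real.exp_le_exp.2 ?_))
  have h2 : 1 / b ≤ 2 := by
    rw [div_le_iff₀ hbpos]; linarith
  have h0 : 0 ≤ 1 / b := by positivity
  simp only [sub_zero, NNReal.coe_pow, NNReal.coe_div, coe_nnnorm, NNReal.coe_ofNat,
    Real.norm_eq_abs, abs_of_nonneg h0]
  have : (1 / b / 2) ^ 2 ≤ 1 := by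
    rw [sq_le_one_iff₀ (by positivity)]; linarith
  nlinarith [sq_nonneg θ]

variable [Fintype ι] [DecidableEq ι]

/-- An event does not depend on where in `B` the coordinates in `I` that lie in `B` are. -/
def InvariantOn (I : Finset ι) (B : Set X) (G : Set (ι → X)) : Prop :=
  ∀ i ∈ I, ∀ ω, ∀ u ∈ B, ∀ v ∈ B, (Function.update ω i u ∈ G ↔ Function.update ω i v ∈ G)

variable {μ : ι → Measure X} [∀ i, IsProbabilityMeasure (μ i)] {I : Finset ι}

/-- Submartingale property of the product weight. Coordinates are switched from `B` to `B'` one at a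
time, each switch being the one-coordinate inequality; invariance of `G` makes the remaining factor
constant on `B`. -/
theorem setLIntegral_prod_expWeight_le (θ : ℝ) {b b' : ℝ}
    {B B' : Set X} (hB : MeasurableSet B) (hB' : MeasurableSet B') (hsub : B' ⊆ B)
    (hb : ∀ i ∈ I, (μ i).real B = b) (hb' : ∀ i ∈ I, (μ i).real B' = b') (hpos : 0 < b')
    {G : Set (ι → X)} (hG : MeasurableSet G) (hinv : InvariantOn I B G) :
    ∫⁻ ω in G, ∏ i ∈ I, expWeight θ b B (ω i) ∂(Measure.pi μ) ≤
      ∫⁻ ω in G, ∏ i ∈ I, expWeight θ b' B' (ω i) ∂(Measure.pi μ) := by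
  have hm := measurable_expWeight θ b hB
  have hm' := measurable_expWeight θ b' hB'
  have hmG : Measurable (G.indicator (1 : (ι → X) → ℝ≥0∞)) := measurable_one.indicator hG
  have key : ∀ J ⊆ I, ∫⁻ ω, G.indicator 1 ω * ∏ i ∈ I, expWeight θ b B (ω i) ∂(Measure.pi μ) ≤
      ∫⁻ ω, G.indicator 1 ω * ∏ i ∈ I, (if i ∈ J then expWeight θ b' B' (ω i) else
        expWeight θ b B (ω i)) ∂(Measure.pi μ) := by
    intro J
    induction J using Finset.induction_on with
    | empty => simp
    | insert j J hj ih =>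
      intro hJ
      have hjI : j ∈ I := hJ (Finset.mem_insert_self j J)
      refine (ih fun i hi => hJ (Finset.mem_insert_of_mem hi)).trans ?_
      have hmJ : ∀ K : Finset ι, Measurable fun ω : ι → X => G.indicator (1 : (ι → X) → ℝ≥0∞) ω *
          ∏ i ∈ I, (if i ∈ K then expWeight θ b' B' (ω i) else expWeight θ b B (ω i)) := by
        intro K
        refine hmG.mul (Finset.measurable_prod _ fun i _ => ?_)
        split_ifs <;> fun_prop
      refine lintegral_le_of_lmarginal_le {j} (hmJ J) (hmJ (insert j J)) fun ω => ?_
      rw [lmarginal_singleton, lmarginal_singleton]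
      set h : X → ℝ≥0∞ := fun v => G.indicator 1 (Function.update ω j v) *
        ∏ i ∈ I.erase j, (if i ∈ J then expWeight θ b' B' (ω i) else expWeight θ b B (ω i)) with hh
      have hsplit : ∀ (K : Finset ι) (v : X), (∀ i, i ≠ j → (i ∈ K ↔ i ∈ J)) →
          G.indicator 1 (Function.update ω j v) * ∏ i ∈ I,
            (if i ∈ K then expWeight θ b' B' (Function.update ω j v i)
              else expWeight θ b B (Function.update ω j v i)) =
          h v * (if j ∈ K then expWeight θ b' B' v else expWeight θ b B v) := by
        intro K v hK
        rw [← Finset.mul_prod_erase I _ hjI, hh]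
        simp only [Function.update_self]
        rw [mul_left_comm, mul_comm (ite _ _ _)]
        congr 2
        refine Finset.prod_congr rfl fun i hi => ?_
        have hij := Finset.ne_of_mem_erase hi
        simp only [Function.update_of_ne hij, hK i hij]
      have e1 := fun v => hsplit J v fun i _ => Iff.rfl
      have e2 := fun v => hsplit (insert j J) v fun i hi => by simp [hi]
      simp only [e1, e2, if_neg hj, Finset.mem_insert_self, if_true]
      refine lintegral_mul_expWeight_le (μ j) θ hB hB' hsub (hb j hjI) (hb' j hjI) hpos ?_
      intro u hu v hv
      simp only [hh]
      refine congrArg (· * _) ?_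
      have := hinv j hjI ω u hu v hv
      by_cases hc : Function.update ω j v ∈ G
      · rw [indicator_of_mem hc, indicator_of_mem (this.2 hc)]
        rfl
      · rw [indicator_of_notMem hc, indicator_of_notMem fun h' => hc (this.1 h')]
  have hfin := key I subset_rfl
  have hind : ∀ f : (ι → X) → ℝ≥0∞, ∫⁻ ω, G.indicator 1 ω * f ω ∂(Measure.pi μ) =
      ∫⁻ ω in G, f ω ∂(Measure.pi μ) := by
    intro f
    rw [← lintegral_indicator hG]
    refine lintegral_congr fun ω => ?_
    by_cases hω : ω ∈ G <;> simp [hω]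
  rw [hind, hind] at hfin
  refine hfin.trans (le_of_eq (lintegral_congr fun ω => Finset.prod_congr rfl fun i hi => ?_))
  rw [if_pos hi]

/-- Maximal inequality for the exponential weights along a decreasing family of sets. -/
theorem mul_measure_exists_le_prod_expWeight (θ : ℝ) {κ : Type*} [LinearOrder κ] (T : Finset κ)
    (m : κ) (hTm : ∀ j ∈ T, j ≤ m) {b : κ → ℝ} {B : κ → Set X} (hB : ∀ j, MeasurableSet (B j))
    (hanti : Antitone B) (hb : ∀ i ∈ I, ∀ j, (μ i).real (B j) = b j) (hpos : 0 < b m)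
    (e : ℝ≥0∞) :
    e * Measure.pi μ {ω | ∃ j ∈ T, e ≤ ∏ i ∈ I, expWeight θ (b j) (B j) (ω i)} ≤
      ∫⁻ ω in {ω | ∃ j ∈ T, e ≤ ∏ i ∈ I, expWeight θ (b j) (B j) (ω i)},
        ∏ i ∈ I, expWeight θ (b m) (B m) (ω i) ∂(Measure.pi μ) := by
  have hmp : ∀ j, Measurable fun ω : ι → X => ∏ i ∈ I, expWeight θ (b j) (B j) (ω i) := by
    intro j
    have := measurable_expWeight θ (b j) (hB j)
    fun_prop
  have hmC : ∀ j, MeasurableSet {ω : ι → X | e ≤ ∏ i ∈ I, expWeight θ (b j) (B j) (ω i)} :=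
    fun j => measurableSet_le measurable_const (hmp j)
  have hmU : ∀ T : Finset κ,
      MeasurableSet {ω : ι → X | ∃ j ∈ T, e ≤ ∏ i ∈ I, expWeight θ (b j) (B j) (ω i)} := by
    intro T
    have : {ω : ι → X | ∃ j ∈ T, e ≤ ∏ i ∈ I, expWeight θ (b j) (B j) (ω i)} =
        ⋃ j ∈ T, {ω : ι → X | e ≤ ∏ i ∈ I, expWeight θ (b j) (B j) (ω i)} := by
      ext; simp
    rw [this]
    exact Finset.measurableSet_biUnion T fun j _ => hmC j
  have hinvw : ∀ j l, j ≤ l → ∀ i : ι, ∀ ω : ι → X, ∀ u ∈ B l, ∀ v ∈ B l,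
      ∏ k ∈ I, expWeight θ (b j) (B j) (Function.update ω i u k) =
        ∏ k ∈ I, expWeight θ (b j) (B j) (Function.update ω i v k) := by
    intro j l hjl i ω u hu v hv
    refine Finset.prod_congr rfl fun k _ => ?_
    by_cases hk : k = i
    · subst hk
      simp [expWeight_of_mem (hanti hjl hu), expWeight_of_mem (hanti hjl hv)]
    · simp [Function.update_of_ne hk]
  -- First-passage decomposition as in Doob's inequality: `C \ U` is the event that the threshold is
  -- reached at `l` and at no earlier index. It depends only on weights of index at most `l`, which
  -- are constant on `B l`, so there the weight at `l` may be replaced by the one at `m`.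
  induction T using Finset.induction_on_max with
  | empty => simp
  | insert l T hl ih =>
    have ih := ih fun j hj => hTm j (Finset.mem_insert_of_mem hj)
    have hlm := hTm l (Finset.mem_insert_self l T)
    set U := {ω : ι → X | ∃ j ∈ T, e ≤ ∏ i ∈ I, expWeight θ (b j) (B j) (ω i)} with hU
    set C := {ω : ι → X | e ≤ ∏ i ∈ I, expWeight θ (b l) (B l) (ω i)} with hC
    have hunion : {ω : ι → X | ∃ j ∈ insert l T, e ≤ ∏ i ∈ I, expWeight θ (b j) (B j) (ω i)} =
        U ∪ (C \ U) := by
      rw [union_sdiff_self]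
      ext ω
      rw [mem_union, mem_ofPred, Finset.exists_mem_insert]
      exact or_comm
    have hmD : MeasurableSet (C \ U) := (hmC l).diff (hmU T)
    rw [hunion, measure_union disjoint_sdiff_right hmD, mul_add,
      lintegral_union hmD disjoint_sdiff_right]
    refine add_le_add ih ?_
    calc e * Measure.pi μ (C \ U) = ∫⁻ _ in C \ U, e ∂(Measure.pi μ) := by
          rw [setLIntegral_const]
      _ ≤ ∫⁻ ω in C \ U, ∏ i ∈ I, expWeight θ (b l) (B l) (ω i) ∂(Measure.pi μ) :=
          setLIntegral_mono (hmp l) fun ω hω => hω.1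
      _ ≤ _ := by
          refine setLIntegral_prod_expWeight_le θ (hB l) (hB m) (hanti hlm)
            (fun i hi => hb i hi l) (fun i hi => hb i hi m) hpos hmD ?_
          intro i _ ω u hu v hv
          simp only [mem_sdiff, hU, hC, mem_ofPred]
          rw [hinvw l l le_rfl i ω u hu v hv]
          refine and_congr_right fun _ => not_congr (exists_congr fun j => and_congr_right
            fun hj => ?_)
          rw [hinvw j l (hl j hj).le i ω u hu v hv]

/-- A one-sided uniform deviation inequality along a decreasing family of sets of probability at
least `1/2`; the sign `σ` selects the side. -/
theorem measure_exists_lt_sum_indicator_le {σ : ℝ} (hσ : σ = 1 ∨ σ = -1) {κ : Type*}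
    [LinearOrder κ] (T : Finset κ) {b : κ → ℝ} {B : κ → Set X} (hB : ∀ j, MeasurableSet (B j))
    (hanti : Antitone B) (hb : ∀ i ∈ I, ∀ j, (μ i).real (B j) = b j)
    (hhalf : ∀ j ∈ T, 1 / 2 ≤ b j) {ε : ℝ} (hε : 0 ≤ ε) :
    Measure.pi μ {ω | ∃ j ∈ T, I.card * ε <
      σ * ∑ i ∈ I, ((B j).indicator (1 : X → ℝ) (ω i) / b j - 1)} ≤
      ENNReal.ofReal (Real.exp (-(I.card * ε ^ 2 / 2))) := by
  rcases T.eq_empty_or_nonempty with rfl | hT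
  · simp
  set m := T.max' hT with hm
  have hmT : m ∈ T := T.max'_mem hT
  have hprod : ∀ θ j (ω : ι → X), ∏ i ∈ I, expWeight θ (b j) (B j) (ω i) = ENNReal.ofReal
      (Real.exp (θ * ∑ i ∈ I, ((B j).indicator (1 : X → ℝ) (ω i) / b j - 1))) := by
    intro θ j ω
    simp only [expWeight]
    rw [Finset.mul_sum, Real.exp_sum, ENNReal.ofReal_prod_of_nonneg fun _ _ => (Real.exp_pos _).le]
  -- With parameter `σ * ε`, a deviation beyond `n ε` pushes the product weight to at least `exp (n
  -- ε²)`, where `n = I.card`, while its mean is at most `exp (n ε² / 2)`; the ratio is the stated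
  -- bound.
  set e := ENNReal.ofReal (Real.exp (I.card * ε ^ 2)) with he
  have hmax := mul_measure_exists_le_prod_expWeight (μ := μ) (I := I) (σ * ε) T m
    (fun j hj => T.le_max' j hj) hB hanti hb (by have := hhalf m hmT; linarith) e
  have htot : ∫⁻ ω, ∏ i ∈ I, expWeight (σ * ε) (b m) (B m) (ω i) ∂(Measure.pi μ) ≤
      ENNReal.ofReal (Real.exp (I.card * ε ^ 2 / 2)) := by
    have hmw := measurable_expWeight (σ * ε) (b m) (hB m)
    rw [lintegral_prod_eq_prod_lintegral_of_indepFun I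
      (fun i (ω : ι → X) => expWeight (σ * ε) (b m) (B m) (ω i))
      (iIndepFun_pi (X := fun _ => expWeight (σ * ε) (b m) (B m)) fun i => hmw.aemeasurable)
      (fun i => by fun_prop)]
    calc ∏ i ∈ I, ∫⁻ ω, expWeight (σ * ε) (b m) (B m) (ω i) ∂(Measure.pi μ)
        ≤ ∏ _i ∈ I, ENNReal.ofReal (Real.exp ((σ * ε) ^ 2 / 2)) := by
          refine Finset.prod_le_prod' fun i hi => ?_
          have : ∫⁻ ω, expWeight (σ * ε) (b m) (B m) (ω i) ∂(Measure.pi μ) =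
              ∫⁻ v, expWeight (σ * ε) (b m) (B m) v ∂(μ i) :=
            (measurePreserving_eval μ i).lintegral_comp hmw
          rw [this]
          exact lintegral_expWeight_le _ _ (hB m) (hb i hi m) (hhalf m hmT)
      _ = _ := by
          rw [Finset.prod_const, ← ENNReal.ofReal_pow (Real.exp_pos _).le, ← Real.exp_nat_mul]
          congr 2
          have : σ ^ 2 = 1 := by rcases hσ with rfl | rfl <;> norm_num
          rw [mul_pow, this]
          ring
  have hsub : {ω : ι → X | ∃ j ∈ T, I.card * ε <
      σ * ∑ i ∈ I, ((B j).indicator (1 : X → ℝ) (ω i) / b j - 1)} ⊆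
      {ω | ∃ j ∈ T, e ≤ ∏ i ∈ I, expWeight (σ * ε) (b j) (B j) (ω i)} := by
    rintro ω ⟨j, hj, hlt⟩
    refine ⟨j, hj, ?_⟩
    rw [hprod, he]
    refine ENNReal.ofReal_le_ofReal (Real.exp_le_exp.2 ?_)
    nlinarith
  refine (measure_mono hsub).trans ?_
  have hfin := hmax.trans ((setLIntegral_le_lintegral _ _).trans htot)
  have he0 : e ≠ 0 := by
    rw [he]; exact (ENNReal.ofReal_pos.2 (Real.exp_pos _)).ne'
  rw [mul_comm, ← ENNReal.le_div_iff_mul_le (Or.inl he0) (Or.inl ENNReal.ofReal_ne_top), he,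
    ← ENNReal.ofReal_div_of_pos (Real.exp_pos _), ← Real.exp_sub] at hfin
  refine hfin.trans (ENNReal.ofReal_le_ofReal (Real.exp_le_exp.2 (le_of_eq ?_)))
  ring

end Maximal

/-! ### Uniform and pointwise deviation inequalities -/

section Deviation

variable {X : Type*} [MeasurableSpace X] {ι : Type*} [Fintype ι] [DecidableEq ι]
  {μ : ι → Measure X} [∀ i, IsProbabilityMeasure (μ i)] {I : Finset ι}

/-- One-sided uniform deviation of an empirical distribution function over finitely many points. -/
theorem measure_exists_mem_cdf_sub_lt_le {φ : X → ℝ} (hφ : Measurable φ) {F : ℝ → ℝ}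
    (hF : ∀ i ∈ I, ∀ t, (μ i).real {v | φ v ≤ t} = F t) {ε : ℝ} (hε : 0 ≤ ε) (T : Finset ℝ) :
    Measure.pi μ {ω | ∃ t ∈ T, I.card * ε <
      I.card * F t - (I.filter fun i => φ (ω i) ≤ t).card} ≤
      2 * ENNReal.ofReal (Real.exp (-(I.card * ε ^ 2 / 2))) := by
  classical
  rcases I.eq_empty_or_nonempty with rfl | ⟨i₀, hi₀⟩
  · simp
  have hF0 : ∀ t, 0 ≤ F t := fun t => hF i₀ hi₀ t ▸ measureReal_nonneg
  have hF1 : ∀ t, F t ≤ 1 := fun t => hF i₀ hi₀ t ▸ measureReal_le_one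
  have hms : ∀ t, MeasurableSet {v | φ v ≤ t} := fun t => measurableSet_le hφ measurable_const
  have hcnt : ∀ (ω : ι → X) t, ∑ i ∈ I, {v | φ v ≤ t}.indicator (1 : X → ℝ) (ω i) =
      (I.filter fun i => φ (ω i) ≤ t).card := by
    intro ω t
    rw [Finset.card_filter]
    push_cast
    exact Finset.sum_congr rfl fun i _ => by simp [indicator_apply]
  have hcnt' : ∀ (ω : ι → X) t, ∑ i ∈ I, {v | φ v ≤ t}ᶜ.indicator (1 : X → ℝ) (ω i) =
      I.card - (I.filter fun i => φ (ω i) ≤ t).card := by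
    intro ω t
    rw [← hcnt, eq_sub_iff_add_eq, ← Finset.sum_add_distrib]
    rw [Finset.sum_congr rfl fun i _ => indicator_compl_add_self_apply {v | φ v ≤ t} 1 (ω i)]
    simp
  -- The maximal inequality needs sets of probability at least `1/2`. Where `F t ≤ 1/2` these are
  -- the upper tails, decreasing in `t`; elsewhere they are the lower half-lines, decreasing in the
  -- dual order. The two cases account for the factor 2.
  have h1 := measure_exists_lt_sum_indicator_le (μ := μ) (I := I) (σ := 1) (Or.inl rfl)
    (T.filter fun t => F t ≤ 1 / 2) (b := fun t => 1 - F t) (B := fun t => {v | φ v ≤ t}ᶜ)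
    (fun t => (hms t).compl)
    (fun s t hst => compl_subset_compl.2 fun v (hv : φ v ≤ s) => hv.trans hst)
    (fun i hi t => by rw [probReal_compl_eq_one_sub (hms t), hF i hi])
    (fun t ht => by have := (Finset.mem_filter.1 ht).2; linarith) hε
  have h2 := measure_exists_lt_sum_indicator_le (μ := μ) (I := I) (σ := -1) (Or.inr rfl)
    (κ := ℝᵒᵈ) ((T.filter fun t => 1 / 2 ≤ F t).map OrderDual.toDual.toEmbedding)
    (b := fun t => F (OrderDual.ofDual t)) (B := fun t => {v | φ v ≤ OrderDual.ofDual t})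
    (fun t => hms _)
    (fun s t hst v hv => le_trans (mem_ofPred.1 hv) hst)
    (fun i hi t => hF i hi _)
    (fun t ht => by
      obtain ⟨t', ht', rfl⟩ := Finset.mem_map.1 ht
      exact (Finset.mem_filter.1 ht').2) hε
  rw [two_mul]
  refine le_trans (measure_mono ?_) ((measure_union_le _ _).trans (add_le_add h1 h2))
  rintro ω ⟨t, ht, hlt⟩
  have hn : (0 : ℝ) ≤ I.card * ε := by positivity
  -- Normalizing by a probability `b ≤ 1` can only enlarge a positive deviation.
  have hdiv : ∀ b : ℝ, 0 < b → b ≤ 1 →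
      I.card * ε < (I.card * F t - (I.filter fun i => φ (ω i) ≤ t).card) / b := by
    intro b hb hb1
    rw [lt_div_iff₀ hb]
    nlinarith
  rcases le_total (F t) (1 / 2) with h | h
  · refine Or.inl ⟨t, Finset.mem_filter.2 ⟨ht, h⟩, ?_⟩
    have hb : 0 < 1 - F t := by linarith
    rw [Finset.sum_sub_distrib, ← Finset.sum_div, hcnt', Finset.sum_const, nsmul_eq_mul]
    convert hdiv (1 - F t) hb (by linarith [hF0 t]) using 1
    field_simp
    ring
  · refine Or.inr ⟨OrderDual.toDual t, Finset.mem_map.2 ⟨t, Finset.mem_filter.2 ⟨ht, h⟩, rfl⟩, ?_⟩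
    have hb : 0 < F t := by linarith
    rw [Finset.sum_sub_distrib, ← Finset.sum_div, OrderDual.ofDual_toDual, hcnt,
      Finset.sum_const, nsmul_eq_mul]
    convert hdiv (F t) hb (hF1 t) using 1
    field_simp
    ring

/-- One-sided Dvoretzky–Kiefer–Wolfowitz inequality. -/
theorem measure_exists_cdf_sub_lt_le {φ : X → ℝ} (hφ : Measurable φ) {F : ℝ → ℝ}
    (hF : ∀ i ∈ I, ∀ t, (μ i).real {v | φ v ≤ t} = F t) {ε : ℝ} (hε : 0 ≤ ε) :
    Measure.pi μ {ω | ∃ t, I.card * ε <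
      I.card * F t - (I.filter fun i => φ (ω i) ≤ t).card} ≤
      2 * ENNReal.ofReal (Real.exp (-(I.card * ε ^ 2 / 2))) := by
  classical
  rcases I.eq_empty_or_nonempty with rfl | ⟨i₀, hi₀⟩
  · simp
  have hmono : Monotone F := fun s t hst => by
    rw [← hF i₀ hi₀, ← hF i₀ hi₀]
    exact measureReal_mono fun v (hv : φ v ≤ s) => hv.trans hst
  let T : ℕ → Finset ℝ := fun n => (Finset.range n).image fun k =>
    (((Denumerable.eqv ℚ).symm k : ℚ) : ℝ)
  set W : Finset ℝ → Set (ι → X) := fun T => {ω | ∃ t ∈ T, I.card * ε <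
      I.card * F t - (I.filter fun i => φ (ω i) ≤ t).card} with hW
  have hWm : Monotone fun n => W (T n) := by
    intro n m hnm ω hω
    obtain ⟨t, ht, h⟩ := hω
    exact ⟨t, Finset.image_subset_image (Finset.range_mono hnm) ht, h⟩
  have hsub : {ω : ι → X | ∃ t, I.card * ε <
      I.card * F t - (I.filter fun i => φ (ω i) ≤ t).card} ⊆ ⋃ n, W (T n) := by
    rintro ω ⟨t, ht⟩
    -- The empirical count is constant from `t` up to the next sample value. A rational in between
    -- has the same count and no smaller `F`, so deviations are detected at rationals, which are
    -- exhausted by finite sets.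
    obtain ⟨u, htu, hu⟩ : ∃ u, t < u ∧ ∀ i ∈ I, t < φ (ω i) → u ≤ φ (ω i) := by
      rcases (I.filter fun i => t < φ (ω i)).eq_empty_or_nonempty with h | h
      · exact ⟨t + 1, by linarith, fun i hi hti => absurd (Finset.mem_filter.2 ⟨hi, hti⟩)
          (h ▸ Finset.notMem_empty i)⟩
      · obtain ⟨j, hj, hmin⟩ := Finset.exists_min_image _ (fun i => φ (ω i)) h
        exact ⟨φ (ω j), (Finset.mem_filter.1 hj).2, fun i hi hti =>
          hmin i (Finset.mem_filter.2 ⟨hi, hti⟩)⟩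
    obtain ⟨q, htq, hqu⟩ := exists_rat_btwn htu
    have hfil : (I.filter fun i => φ (ω i) ≤ (q : ℝ)) = I.filter fun i => φ (ω i) ≤ t := by
      refine Finset.filter_congr fun i hi => ⟨fun h => ?_, fun h => h.trans htq.le⟩
      by_contra hc
      exact absurd (h.trans_lt hqu) (not_lt.2 (hu i hi (not_le.1 hc)))
    refine mem_iUnion.2 ⟨Denumerable.eqv ℚ q + 1, (q : ℝ), ?_, ?_⟩
    · exact Finset.mem_image.2 ⟨Denumerable.eqv ℚ q, Finset.self_mem_range_succ _,
        by rw [Equiv.symm_apply_apply]⟩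
    · rw [hfil]
      have := mul_le_mul_of_nonneg_left (hmono htq.le) (Nat.cast_nonneg (α := ℝ) I.card)
      linarith
  refine (measure_mono hsub).trans ?_
  rw [hWm.measure_iUnion]
  exact iSup_le fun n => measure_exists_mem_cdf_sub_lt_le hφ hF hε (T n)

omit [DecidableEq ι] in
/-- Hoeffding's inequality for the empirical frequency of an event. -/
theorem measure_le_sub_card_le {B : Set X} [DecidablePred (· ∈ B)] (hB : MeasurableSet B) {b : ℝ}
    (hb : ∀ i ∈ I, (μ i).real B = b) {ε : ℝ} (hε : 0 ≤ ε) :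
    Measure.pi μ {ω | I.card * ε ≤ I.card * b - (I.filter fun i => ω i ∈ B).card} ≤
      ENNReal.ofReal (Real.exp (-(2 * I.card * ε ^ 2))) := by
  rcases I.eq_empty_or_nonempty with rfl | hI
  · simp
  have hm : Measurable (B.indicator (1 : X → ℝ)) := measurable_one.indicator hB
  have hsub : ∀ i ∈ I, HasSubgaussianMGF
      (fun ω : ι → X => -(B.indicator (1 : X → ℝ) (ω i) - (μ i).real B))
      ((‖(1 : ℝ) - 0‖₊ / 2) ^ 2) (Measure.pi μ) := by
    intro i hi
    have h1 := hasSubgaussianMGF_of_mem_Icc (μ := Measure.pi μ) (a := 0) (b := 1)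
      (X := fun ω : ι → X => B.indicator (1 : X → ℝ) (ω i))
      (hm.comp (measurable_pi_apply i)).aemeasurable
      (.of_forall fun ω => by by_cases h : ω i ∈ B <;> simp [h])
    have h2 : ∫ ω, B.indicator (1 : X → ℝ) (ω i) ∂(Measure.pi μ) = (μ i).real B := by
      rw [integral_comp_eval (μ := μ) (i := i) hm.aestronglyMeasurable, integral_indicator_one hB]
    rw [h2] at h1
    exact h1.neg
  have hind : iIndepFun (fun i (ω : ι → X) => -(B.indicator (1 : X → ℝ) (ω i) - (μ i).real B))
      (Measure.pi μ) :=
    iIndepFun_pi (X := fun i v => -(B.indicator (1 : X → ℝ) v - (μ i).real B))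
      fun i => Measurable.aemeasurable (by fun_prop)
  have hoeff := HasSubgaussianMGF.measure_sum_ge_le_of_iIndepFun hind hsub
    (ε := I.card * ε) (by positivity)
  rw [← ofReal_measureReal]
  refine ENNReal.ofReal_le_ofReal (le_trans (le_of_eq ?_) (hoeff.trans (Real.exp_le_exp.2
    (le_of_eq ?_))))
  · congr 1
    ext ω
    simp only [mem_ofPred]
    have e : ∑ i ∈ I, -(B.indicator (1 : X → ℝ) (ω i) - (μ i).real B) =
        I.card * b - (I.filter fun i => ω i ∈ B).card := by
      rw [Finset.card_filter, Finset.sum_congr rfl fun i hi => by rw [hb i hi]]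
      push_cast
      rw [Finset.sum_neg_distrib, Finset.sum_sub_distrib, Finset.sum_const, nsmul_eq_mul, neg_sub]
      congr 1
      exact Finset.sum_congr rfl fun i _ => by simp [indicator_apply]
    rw [e]
  · have hc : (0 : ℝ) < I.card := by exact_mod_cast hI.card_pos
    simp
    field_simp

end Deviation

/-! ### Simultaneous accuracy of the empirical model -/

section Accuracy

variable {S A : Type*} [DecidableEq S] [DecidableEq A] {N : ℕ}

/-- The empirical reward and transition distributions at `(s, a)` do not undershoot the true ones
by more than `ε₁` on lower half-lines and by more than `ε₂` on sets of states, respectively. -/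
def IsAccurate (M : MDP S A) (x : Fin N → S × A) (s : S) (a : A) (ε₁ ε₂ : ℝ)
    (ω : Fin N → ℝ × S) : Prop :=
  (∀ t, (M.R s a : Measure ℝ).real (Iic t) - (empiricalR x ω s a).real (Iic t) ≤ ε₁) ∧
    ∀ T : Finset S, ∑ s' ∈ T, ((M.P s a s').toReal - (empiricalP x ω s a s').toReal) ≤ ε₂

theorem empiricalR_real_Iic (x : Fin N → S × A) (ω : Fin N → ℝ × S) (s : S) (a : A) (t : ℝ) :
    (empiricalR x ω s a).real (Iic t) =
      ((Finset.univ.filter fun i => x i = (s, a)).filter fun i => (ω i).1 ≤ t).card /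
        visits x s a := by
  simp only [empiricalR, Measure.real, Measure.smul_apply, Measure.finsetSum_apply, smul_eq_mul,
    ENNReal.toReal_mul, ENNReal.toReal_inv, ENNReal.toReal_natCast]
  rw [div_eq_inv_mul, ENNReal.toReal_sum (fun i _ => measure_ne_top _ _), Finset.card_filter]
  push_cast
  congr 1
  refine Finset.sum_congr rfl fun i _ => ?_
  rw [Measure.dirac_apply' _ measurableSet_Iic]
  by_cases h : (ω i).1 ≤ t <;> simp [h]

theorem sum_empiricalP_toReal (x : Fin N → S × A) (ω : Fin N → ℝ × S) (s : S) (a : A)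
    (T : Finset S) :
    ∑ s' ∈ T, (empiricalP x ω s a s').toReal =
      ((Finset.univ.filter fun i => x i = (s, a)).filter fun i => (ω i).2 ∈ T).card /
        visits x s a := by
  simp only [empiricalP, ENNReal.toReal_div, ENNReal.toReal_natCast]
  rw [← Finset.sum_div, ← Nat.cast_sum]
  congr 2
  rw [Finset.card_eq_sum_card_fiberwise (f := fun i => (ω i).2) (t := T)
    (fun i hi => Finset.mem_coe.2 (Finset.mem_filter.1 (Finset.mem_coe.1 hi)).2)]
  refine Finset.sum_congr rfl fun s' hs' => congrArg Finset.card ?_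
  ext i
  simp only [Finset.mem_filter, Finset.mem_univ, true_and]
  constructor
  · rintro ⟨h1, h2⟩
    exact ⟨⟨h1, h2 ▸ hs'⟩, h2⟩
  · rintro ⟨⟨h1, _⟩, h2⟩
    exact ⟨h1, h2⟩

variable [Fintype S] [MeasurableSpace S] [MeasurableSingletonClass S]

/-- The samples at a fixed pair are independent with a common law. The first term is the uniform CDF
bound for rewards; the second is Hoeffding's inequality summed over all `2 ^ |S|` sets of states. -/
theorem measure_not_isAccurate_le (M : MDP S A) (x : Fin N → S × A) {s : S} {a : A}
    (hn : 0 < visits x s a) {ε₁ ε₂ : ℝ} (hε₁ : 0 ≤ ε₁) (hε₂ : 0 ≤ ε₂) :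
    dataLaw M x {ω | ¬ IsAccurate M x s a ε₁ ε₂ ω} ≤
      2 * ENNReal.ofReal (Real.exp (-(visits x s a * ε₁ ^ 2 / 2))) +
      2 ^ Fintype.card S * ENNReal.ofReal (Real.exp (-(2 * visits x s a * ε₂ ^ 2))) := by
  classical
  set I := Finset.univ.filter fun i => x i = (s, a) with hI
  have hIc : I.card = visits x s a := rfl
  have hn' : (0 : ℝ) < I.card := by exact_mod_cast hn
  let μ : Fin N → Measure (ℝ × S) := fun i =>
    (M.R (x i).1 (x i).2 : Measure ℝ).prod (M.P (x i).1 (x i).2).toMeasure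
  have hμ : ∀ i ∈ I, μ i = (M.R s a : Measure ℝ).prod (M.P s a).toMeasure := by
    intro i hi
    have : x i = (s, a) := (Finset.mem_filter.1 hi).2
    simp only [μ, this]
  have h1 := measure_exists_cdf_sub_lt_le (μ := μ) (I := I) (φ := Prod.fst) measurable_fst
    (F := fun t => (M.R s a : Measure ℝ).real (Iic t)) (fun i hi t => by
      rw [hμ i hi, show {v : ℝ × S | v.1 ≤ t} = Iic t ×ˢ univ by ext; simp, measureReal_prod_prod]
      simp) hε₁
  have h2 : ∀ T : Finset S, Measure.pi μ {ω | I.card * ε₂ ≤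
      I.card * (∑ s' ∈ T, (M.P s a s').toReal) - (I.filter fun i => (ω i).2 ∈ T).card} ≤
      ENNReal.ofReal (Real.exp (-(2 * I.card * ε₂ ^ 2))) := by
    intro T
    have h := measure_le_sub_card_le (μ := μ) (I := I) (B := {v : ℝ × S | v.2 ∈ T})
      (b := ∑ s' ∈ T, (M.P s a s').toReal)
      (measurable_snd (T.measurableSet : MeasurableSet (T : Set S))) (fun i hi => by
        rw [hμ i hi, show {v : ℝ × S | v.2 ∈ T} = univ ×ˢ (T : Set S) by ext; simp,
          measureReal_prod_prod]
        rw [Measure.real, Measure.real, measure_univ, ENNReal.toReal_one, one_mul,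
          PMF.toMeasure_apply_finset, ENNReal.toReal_sum fun s' _ => PMF.apply_ne_top _ _]) hε₂
    exact h
  have hsub : {ω | ¬ IsAccurate M x s a ε₁ ε₂ ω} ⊆
      {ω | ∃ t, I.card * ε₁ < I.card * (M.R s a : Measure ℝ).real (Iic t) -
        (I.filter fun i => (ω i).1 ≤ t).card} ∪
      ⋃ T : Finset S, {ω | I.card * ε₂ ≤
        I.card * (∑ s' ∈ T, (M.P s a s').toReal) - (I.filter fun i => (ω i).2 ∈ T).card} := by
    intro ω hω
    rw [mem_ofPred, IsAccurate, not_and_or, not_forall, not_forall] at hω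
    rcases hω with ⟨t, ht⟩ | ⟨T, hT⟩
    · refine Or.inl ⟨t, ?_⟩
      rw [not_le, empiricalR_real_Iic, ← hI, ← hIc] at ht
      have := mul_lt_mul_of_pos_left ht hn'
      rwa [mul_sub, mul_div_cancel₀ _ hn'.ne'] at this
    · refine Or.inr (mem_iUnion.2 ⟨T, ?_⟩)
      rw [not_le, Finset.sum_sub_distrib, sum_empiricalP_toReal, ← hI, ← hIc] at hT
      have := (mul_lt_mul_of_pos_left hT hn').le
      rwa [mul_sub, mul_div_cancel₀ _ hn'.ne'] at this
  refine (measure_mono hsub).trans ((measure_union_le _ _).trans (add_le_add h1 ?_))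
  refine (measure_iUnion_le _).trans ?_
  rw [tsum_fintype]
  refine (Finset.sum_le_sum fun T _ => h2 T).trans (le_of_eq ?_)
  rw [Finset.sum_const, Finset.card_univ, Fintype.card_finset, nsmul_eq_mul]
  push_cast
  rfl

/-- The failure probability of the estimates at one state-action pair. -/
theorem measure_not_isAccurate_le_div [Fintype A] (M : MDP S A) (x : Fin N → S × A) {s : S} {a : A}
    (hn : 0 < visits x s a) {δ : ℝ} (hδ : 0 < δ) (hδ1 : δ < 1) {L : ℝ}
    (hL : L = Real.log (4 * Fintype.card S * Fintype.card A / δ)) :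
    dataLaw M x {ω | ¬ IsAccurate M x s a √(2 * (Fintype.card S / visits x s a * L))
      √(Fintype.card S / visits x s a * L / 2) ω} ≤
      ENNReal.ofReal (δ / (Fintype.card S * Fintype.card A)) := by
  have hk : 0 < Fintype.card S := Fintype.card_pos_iff.2 ⟨s⟩
  have hA : 0 < Fintype.card A := Fintype.card_pos_iff.2 ⟨a⟩
  set k := Fintype.card S
  set m := Fintype.card A
  set n := visits x s a
  have hk' : (1 : ℝ) ≤ k := by exact_mod_cast hk
  have hm' : (1 : ℝ) ≤ m := by exact_mod_cast hA
  have hn' : (0 : ℝ) < n := by exact_mod_cast hn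
  have hkm : (1 : ℝ) ≤ k * m := one_le_mul_of_one_le_of_one_le hk' hm'
  have hbig : 4 < 4 * k * m / δ := by
    rw [lt_div_iff₀ hδ]; nlinarith
  have hL0 : 0 < L := hL ▸ Real.log_pos (by linarith)
  have hE : Real.exp (-L) = δ / (k * m) / 4 := by
    rw [Real.exp_neg, hL, Real.exp_log (by linarith)]
    field_simp
  have hE4 : Real.exp (-L) ≤ 1 / 4 := by
    rw [hE]
    have : δ / (k * m) ≤ 1 := by
      rw [div_le_one (by linarith)]; linarith
    linarith
  have hE0 := (Real.exp_pos (-L)).le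
  have hq : 0 ≤ (k : ℝ) / n * L := by positivity
  have hx : Real.exp (-(k * L)) = Real.exp (-L) ^ k := by
    rw [← Real.exp_nat_mul]; congr 1; ring
  refine (measure_not_isAccurate_le M x hn (Real.sqrt_nonneg _) (Real.sqrt_nonneg _)).trans ?_
  rw [Real.sq_sqrt (by positivity), Real.sq_sqrt (by positivity)]
  -- Both error levels are tuned to make the exponent `-|S| L`. Since `exp (-L) ≤ 1/4`, each of `2
  -- exp (-|S| L)` and `2 ^ |S| exp (-|S| L)` is at most `2 exp (-L)`, and `4 exp (-L)` is the share
  -- of `δ` allotted to one pair.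
  have e1 : -((n : ℝ) * (2 * (k / n * L)) / 2) = -(k * L) := by field_simp
  have e2 : -(2 * (n : ℝ) * (k / n * L / 2)) = -(k * L) := by field_simp
  rw [e1, e2, hx]
  have h2 : (2 : ℝ≥0∞) = ENNReal.ofReal 2 := by simp
  rw [h2, ← ENNReal.ofReal_pow (by norm_num), ← ENNReal.ofReal_mul (by norm_num),
    ← ENNReal.ofReal_mul (by positivity), ← ENNReal.ofReal_add (by positivity) (by positivity),
    ← mul_pow]
  refine ENNReal.ofReal_le_ofReal ?_
  have b1 : Real.exp (-L) ^ k ≤ Real.exp (-L) := pow_le_of_le_one hE0 (by linarith) hk.ne'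
  have b2 : (2 * Real.exp (-L)) ^ k ≤ 2 * Real.exp (-L) :=
    pow_le_of_le_one (by linarith) (by linarith) hk.ne'
  have : 4 * Real.exp (-L) = δ / (k * m) := by rw [hE]; ring
  linarith

omit [DecidableEq S] [DecidableEq A] [Fintype S] [MeasurableSingletonClass S] in
theorem ae_dataLaw_reward_mem (M : MDP S A) (x : Fin N → S × A) :
    ∀ᵐ ω ∂(dataLaw M x), ∀ i, (ω i).1 ∈ Icc (M.Rmin) (M.Rmax) := by
  rw [ae_all_iff]
  intro i
  have h1 : ∀ᵐ v ∂((M.R (x i).1 (x i).2 : Measure ℝ).prod (M.P (x i).1 (x i).2).toMeasure),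
      v.1 ∈ Icc M.Rmin M.Rmax :=
    Measure.quasiMeasurePreserving_fst.ae (M.reward_mem (x i).1 (x i).2)
  exact (Measure.quasiMeasurePreserving_eval (fun i =>
    (M.R (x i).1 (x i).2 : Measure ℝ).prod (M.P (x i).1 (x i).2).toMeasure) i).ae h1

/-- With probability at least `1 - δ` all estimates are accurate. -/
theorem exists_event_isAccurate [Fintype A] (M : MDP S A) (x : Fin N → S × A) {δ : ℝ}
    (hδ : 0 < δ) {L : ℝ} (hL : L = Real.log (4 * Fintype.card S * Fintype.card A / δ)) :
    ∃ E : Set (Fin N → ℝ × S), MeasurableSet E ∧ 1 - ENNReal.ofReal δ ≤ dataLaw M x E ∧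
      ∀ ω ∈ E, (∀ i, (ω i).1 ∈ Icc M.Rmin M.Rmax) ∧ ∀ s a, 0 < visits x s a → 0 < L ∧
        IsAccurate M x s a √(2 * (Fintype.card S / visits x s a * L))
          √(Fintype.card S / visits x s a * L / 2) ω := by
  -- For `δ ≥ 1` the empty event suffices. Otherwise `L` is positive, whereas for large `δ` it could
  -- be negative.
  rcases le_or_gt 1 δ with h1 | h1
  · refine ⟨∅, MeasurableSet.empty, ?_, by simp⟩
    rw [tsub_eq_zero_of_le (by simpa using h1)]
    exact zero_le
  have hprob : IsProbabilityMeasure (dataLaw M x) := by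
    unfold dataLaw; infer_instance
  set W : Set (Fin N → ℝ × S) := {ω | ¬ ∀ i, (ω i).1 ∈ Icc M.Rmin M.Rmax} ∪
    ⋃ q : S × A, {ω | 0 < visits x q.1 q.2 ∧
      ¬ IsAccurate M x q.1 q.2 √(2 * (Fintype.card S / visits x q.1 q.2 * L))
        √(Fintype.card S / visits x q.1 q.2 * L / 2) ω} with hW
  have hWle : dataLaw M x W ≤ ENNReal.ofReal δ := by
    refine (measure_union_le _ _).trans ?_
    rw [show dataLaw M x {ω | ¬ ∀ i, (ω i).1 ∈ Icc M.Rmin M.Rmax} = 0 from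
      ae_dataLaw_reward_mem M x, zero_add]
    refine (measure_iUnion_le _).trans ?_
    rw [tsum_fintype]
    have hq : ∀ q : S × A, dataLaw M x {ω | 0 < visits x q.1 q.2 ∧
      ¬ IsAccurate M x q.1 q.2 √(2 * (Fintype.card S / visits x q.1 q.2 * L))
        √(Fintype.card S / visits x q.1 q.2 * L / 2) ω} ≤
        ENNReal.ofReal (δ / (Fintype.card S * Fintype.card A)) := by
      intro q
      by_cases hn : 0 < visits x q.1 q.2
      · simpa only [hn, true_and] using measure_not_isAccurate_le_div M x hn hδ h1 hL
      · simp [hn]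
    refine (Finset.sum_le_sum fun q _ => hq q).trans ?_
    rw [Finset.sum_const, Finset.card_univ, Fintype.card_prod, nsmul_eq_mul,
      ← ENNReal.ofReal_natCast, ← ENNReal.ofReal_mul (Nat.cast_nonneg _)]
    refine ENNReal.ofReal_le_ofReal ?_
    push_cast
    rcases (by positivity : (0 : ℝ) ≤ Fintype.card S * Fintype.card A).eq_or_lt with h0 | h0
    · rw [← h0, zero_mul]; exact hδ.le
    · rw [mul_div_cancel₀ _ h0.ne']
  -- The bad set is enlarged to a measurable hull of the same measure, so its own measurability is
  -- not needed.
  refine ⟨(toMeasurable (dataLaw M x) W)ᶜ, (measurableSet_toMeasurable _ _).compl, ?_, ?_⟩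
  · rw [prob_compl_eq_one_sub (measurableSet_toMeasurable _ _), measure_toMeasurable]
    exact tsub_le_tsub_left hWle _
  · intro ω hω
    have hω' : ω ∉ W := fun h => hω (subset_toMeasurable _ _ h)
    rw [hW, mem_union, not_or, mem_iUnion, not_exists] at hω'
    refine ⟨not_not.1 hω'.1, fun s a hn => ⟨?_, ?_⟩⟩
    · have hk : (1 : ℝ) ≤ Fintype.card S := by exact_mod_cast Fintype.card_pos_iff.2 ⟨s⟩
      have hm : (1 : ℝ) ≤ Fintype.card A := by exact_mod_cast Fintype.card_pos_iff.2 ⟨a⟩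
      rw [hL]
      refine Real.log_pos ?_
      rw [lt_div_iff₀ hδ]
      nlinarith
    · by_contra hc
      exact hω'.2 (s, a) ⟨hn, hc⟩

end Accuracy

/-! ### The true return laws as a sub-solution -/

section Improvement

variable {S A : Type*} [Fintype S] [Fintype A]

/-- The CDF of a Bellman update as an average of reward CDFs. -/
theorem bellmanOp_real_Iic {γ : ℝ} {P : S → A → S → ℝ≥0∞}
    {R : S → A → Measure ℝ} {pol : S → PMF A} {Z : S → A → Measure ℝ}
    [∀ s a, IsProbabilityMeasure (Z s a)] {s : S} {a : A} [IsProbabilityMeasure (R s a)]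
    (hP : ∀ s', P s a s' ≠ ∞) (y : ℝ) :
    (bellmanOp γ P R pol Z s a).real (Iic y) = ∑ s' : S, (P s a s').toReal *
      ∑ a' : A, (pol s' a').toReal * ∫ z, (R s a).real (Iic (y - γ * z)) ∂(Z s' a') := by
  have hm : MeasurableSet ((fun u : ℝ × ℝ => u.1 + γ * u.2) ⁻¹' Iic y) :=
    (by fun_prop : Measurable fun u : ℝ × ℝ => u.1 + γ * u.2) measurableSet_Iic
  simp only [Measure.real, bellmanOp, Measure.finsetSum_apply, Measure.smul_apply, smul_eq_mul]
  have ht : ∀ s' a', P s a s' * pol s' a' *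
      (((R s a).prod (Z s' a')).map (fun u => u.1 + γ * u.2)) (Iic y) ≠ ∞ := by
    intro s' a'
    have : IsProbabilityMeasure (((R s a).prod (Z s' a')).map (fun u => u.1 + γ * u.2)) :=
      Measure.isProbabilityMeasure_map (by fun_prop)
    exact ENNReal.mul_ne_top (ENNReal.mul_ne_top (hP s') (PMF.apply_ne_top _ _))
      (measure_ne_top _ _)
  rw [ENNReal.toReal_sum fun s' _ => ENNReal.sum_ne_top.2 fun a' _ => ht s' a']
  refine Finset.sum_congr rfl fun s' _ => ?_
  rw [ENNReal.toReal_sum fun a' _ => ht s' a', Finset.mul_sum]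
  refine Finset.sum_congr rfl fun a' _ => ?_
  rw [ENNReal.toReal_mul, ENNReal.toReal_mul, mul_assoc]
  congr 2
  rw [Measure.map_apply (by fun_prop) measurableSet_Iic, Measure.prod_apply_symm hm,
    integral_toReal]
  · congr 1
    refine lintegral_congr fun z => ?_
    congr 1
    ext r
    simp only [mem_preimage, mem_Iic]
    constructor <;> intro h <;> linarith
  · exact ((measurable_measure_Iic (R s a)).comp
      (by fun_prop : Measurable fun z => y - γ * z)).aemeasurable
  · exact .of_forall fun z => measure_lt_top _ _

variable [DecidableEq S] [DecidableEq A] {N : ℕ} {x : Fin N → S × A} {ω : Fin N → ℝ × S}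
  {M : MDP S A} {pol : S → PMF A}

omit [Fintype S] [Fintype A] in
theorem empiricalP_ne_top (s : S) (a : A) (s' : S) (hn : 0 < visits x s a) :
    empiricalP x ω s a s' ≠ ∞ :=
  ENNReal.div_ne_top (ENNReal.natCast_ne_top _) (by exact_mod_cast hn.ne')

/-- One application of the empirical Bellman operator instead of the true one lowers CDFs by at
most the sum of the estimation errors. -/
theorem IsAccurate.bellmanOp_sub_le {s : S} {a : A} {ε₁ ε₂ : ℝ} (h : IsAccurate M x s a ε₁ ε₂ ω)
    (hn : 0 < visits x s a) (Z : S → A → Measure ℝ) [∀ s a, IsProbabilityMeasure (Z s a)] (y : ℝ) :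
    (bellmanOp M.γ (fun s a s' => M.P s a s') (fun s a => M.R s a) pol Z s a).real (Iic y) -
      (empiricalBellmanOp M pol x ω Z s a).real (Iic y) ≤ ε₁ + ε₂ := by
  have := isProbabilityMeasure_empiricalR (ω := ω) hn
  rw [empiricalBellmanOp, bellmanOp_real_Iic (fun s' => PMF.apply_ne_top _ _) y,
    bellmanOp_real_Iic (fun s' => empiricalP_ne_top s a s' hn) y]
  have hpol : ∀ s', ∑ a', (pol s' a').toReal = 1 := by
    intro s'
    rw [← ENNReal.toReal_sum fun _ _ => PMF.apply_ne_top _ _, ← tsum_fintype (L := .unconditional _),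
      PMF.tsum_coe, ENNReal.toReal_one]
  have hPh : ∑ s', (empiricalP x ω s a s').toReal = 1 := by
    rw [← ENNReal.toReal_sum fun s' _ => empiricalP_ne_top s a s' hn, sum_empiricalP hn,
      ENNReal.toReal_one]
  have hint : ∀ (R : Measure ℝ) [IsProbabilityMeasure R] s' a',
      Integrable (fun z => R.real (Iic (y - M.γ * z))) (Z s' a') := by
    intro R _ s' a'
    refine Integrable.of_bound (C := 1) ?_ (.of_forall fun z => ?_)
    · exact ((measurable_measure_Iic R).comp
        (by fun_prop : Measurable fun z => y - M.γ * z)).ennreal_toReal.aestronglyMeasurable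
    · rw [Real.norm_eq_abs, abs_of_nonneg measureReal_nonneg]
      exact measureReal_le_one
  set J : S → ℝ := fun s' => ∑ a', (pol s' a').toReal *
    ∫ z, (M.R s a : Measure ℝ).real (Iic (y - M.γ * z)) ∂(Z s' a') with hJ
  set J' : S → ℝ := fun s' => ∑ a', (pol s' a').toReal *
    ∫ z, (empiricalR x ω s a).real (Iic (y - M.γ * z)) ∂(Z s' a') with hJ'
  have hJ0 : ∀ s', 0 ≤ J s' := fun s' => Finset.sum_nonneg fun a' _ =>
    mul_nonneg ENNReal.toReal_nonneg (integral_nonneg fun z => measureReal_nonneg)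
  have hJ1 : ∀ s', J s' ≤ 1 := by
    intro s'
    rw [← hpol s']
    refine Finset.sum_le_sum fun a' _ => mul_le_of_le_one_right ENNReal.toReal_nonneg ?_
    calc ∫ z, (M.R s a : Measure ℝ).real (Iic (y - M.γ * z)) ∂(Z s' a') ≤ ∫ _, 1 ∂(Z s' a') :=
          integral_mono (hint _ s' a') (integrable_const _) fun z => measureReal_le_one
      _ = 1 := by simp
  have hJJ : ∀ s', J s' - J' s' ≤ ε₁ := by
    intro s'
    rw [hJ, hJ', ← Finset.sum_sub_distrib]
    calc ∑ a', ((pol s' a').toReal *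
          ∫ z, (M.R s a : Measure ℝ).real (Iic (y - M.γ * z)) ∂(Z s' a') - (pol s' a').toReal *
          ∫ z, (empiricalR x ω s a).real (Iic (y - M.γ * z)) ∂(Z s' a'))
        ≤ ∑ a', (pol s' a').toReal * ε₁ := by
          refine Finset.sum_le_sum fun a' _ => ?_
          rw [← mul_sub, ← integral_sub (hint _ s' a') (hint _ s' a')]
          refine mul_le_mul_of_nonneg_left ?_ ENNReal.toReal_nonneg
          calc _ ≤ ∫ _, ε₁ ∂(Z s' a') :=
                integral_mono ((hint _ s' a').sub (hint _ s' a')) (integrable_const _)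
                  fun z => h.1 _
            _ = ε₁ := by simp
      _ = ε₁ := by rw [← Finset.sum_mul, hpol, one_mul]
  -- The reward error is averaged with the empirical transition weights, and the transition error is
  -- tested against `J`, which takes values in `[0, 1]`.
  have hsplit : ∑ s', (M.P s a s').toReal * J s' - ∑ s', (empiricalP x ω s a s').toReal * J' s' =
      ∑ s', (empiricalP x ω s a s').toReal * (J s' - J' s') +
      ∑ s', ((M.P s a s').toReal - (empiricalP x ω s a s').toReal) * J s' := by
    rw [← Finset.sum_sub_distrib, ← Finset.sum_add_distrib]
    exact Finset.sum_congr rfl fun _ _ => by ring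
  rw [hsplit]
  refine add_le_add ?_ ?_
  · calc _ ≤ ∑ s', (empiricalP x ω s a s').toReal * ε₁ :=
          Finset.sum_le_sum fun s' _ => mul_le_mul_of_nonneg_left (hJJ s') ENNReal.toReal_nonneg
      _ = ε₁ := by rw [← Finset.sum_mul, hPh, one_mul]
  -- Against a function with values in `[0, 1]` the error is largest on the indicator of the states
  -- whose probability is not overestimated, hence the one-sided bound over all sets of states.
  · refine le_trans ?_ (h.2 (Finset.univ.filter fun s' =>
      0 ≤ (M.P s a s').toReal - (empiricalP x ω s a s').toReal))
    rw [Finset.sum_filter]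
    refine Finset.sum_le_sum fun s' _ => ?_
    split_ifs with h0
    · exact mul_le_of_le_one_right h0 (hJ1 s')
    · exact mul_nonpos_of_nonpos_of_nonneg (not_le.1 h0).le (hJ0 s')

variable [MeasurableSpace S] [MeasurableSpace A]
  [MeasurableSingletonClass S] [MeasurableSingletonClass A]

omit [DecidableEq S] [DecidableEq A] in
theorem StronglyMonotoneReturns.mul_sub_le {ζ : ℝ} (hreg : StronglyMonotoneReturns M pol ζ)
    (s : S) (a : A) {y w : ℝ} (hy : y ∈ Icc M.Vmin M.Vmax) (hw : w ∈ Icc M.Vmin M.Vmax)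
    (hyw : y ≤ w) :
    ζ * (w - y) ≤ (returnLaw M pol s a).real (Iic w) - (returnLaw M pol s a).real (Iic y) := by
  rw [← cdf_eq_real, ← cdf_eq_real]
  obtain ⟨hc, hd⟩ := hreg s a
  have hdiff := hc.differentiableOn (by simp)
  refine (convex_Icc _ _).mul_sub_le_image_sub_of_le_deriv hc.continuousOn
    (hdiff.mono interior_subset) (fun t ht => ?_) y hy w hw hyw
  rw [← derivWithin_of_mem_nhds (mem_interior_iff_mem_nhds.1 ht)]
  exact hd t (interior_subset ht)

/-- Observed rewards are at most `Rmax`, and `Rmax + γ Vmax = Vmax`, so the empirical update keeps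
the upper bound on the support. -/
theorem empiricalBellmanOp_returnLaw_Iic {s : S} {a : A} (hn : 0 < visits x s a)
    (hr : ∀ i, (ω i).1 ≤ M.Rmax) {y : ℝ} (hy : M.Vmax ≤ y) :
    (empiricalBellmanOp M pol x ω (returnLaw M pol) s a).real (Iic y) = 1 := by
  have h1γ : 0 < 1 - M.γ := by linarith [M.γ_lt_one]
  have hγ := M.γ_pos
  have h := shiftOp_bellmanOp_Iic (c := fun _ _ => 0) (P := empiricalP x ω) (pol := pol)
    (R := empiricalR x ω) (s := s) (a := a) hγ
    (Z := returnLaw M pol) (fun s' a' _ => inferInstance) y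
  have hs : shiftOp (fun _ _ => 0) (bellmanOp M.γ (empiricalP x ω) (empiricalR x ω) pol
      (returnLaw M pol)) s a = empiricalBellmanOp M pol x ω (returnLaw M pol) s a := by
    simp [shiftOp, empiricalBellmanOp]
  have hone : ∀ s' a', ∫⁻ r, returnLaw M pol s' a' (Iic ((y - (r - 0)) / M.γ))
      ∂(empiricalR x ω s a) = 1 := by
    intro s' a'
    have := isProbabilityMeasure_empiricalR (ω := ω) hn
    have hae : ∀ᵐ r ∂(empiricalR x ω s a),
        returnLaw M pol s' a' (Iic ((y - (r - 0)) / M.γ)) = 1 := by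
      filter_upwards [ae_empiricalR (q := fun r => r ≤ M.Rmax) fun i _ => hr i] with r hr'
      refine (mem_ae_iff_prob_eq_one measurableSet_Iic).1 ?_
      filter_upwards [MDP.ae_mem_returnLaw M pol s' a'] with z hz
      refine hz.2.trans ?_
      rw [le_div_iff₀ hγ]
      have : M.Vmax * (1 - M.γ) = M.Rmax := by
        rw [MDP.Vmax, div_mul_cancel₀ _ h1γ.ne']
      linarith
    rw [lintegral_congr_ae hae]
    simp
  rw [hs] at h
  simp only [hone, mul_one, sum_empiricalP_mul_pmf pol hn] at h
  rw [Measure.real, h, ENNReal.toReal_one]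

/-- If the shift exceeds the estimation error, the operator lowers the true return distributions
in stochastic order. -/
theorem returnLaw_Iic_le_cdeOp {p α : ℝ} {c₀ : S → A → ℝ} {s : S} {a : A} {ε₁ ε₂ ζ : ℝ}
    (hζ : 0 < ζ) (hreg : StronglyMonotoneReturns M pol ζ) (h : IsAccurate M x s a ε₁ ε₂ ω)
    (hn : 0 < visits x s a) (hr : ∀ i, (ω i).1 ≤ M.Rmax) (hε : 0 ≤ ε₁ + ε₂)
    (hc : (ε₁ + ε₂) / ζ ≤ penalty p α c₀ s a) (y : ℝ) :
    returnLaw M pol s a (Iic y) ≤ cdeOp M pol p α c₀ x ω (returnLaw M pol) s a (Iic y) := by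
  set c := penalty p α c₀ s a with hcdef
  have hc0 : 0 ≤ c := le_trans (div_nonneg hε hζ.le) hc
  have hpre : cdeOp M pol p α c₀ x ω (returnLaw M pol) s a (Iic y) =
      empiricalBellmanOp M pol x ω (returnLaw M pol) s a (Iic (y + c)) := by
    rw [cdeOp, shiftOp, Measure.map_apply (by fun_prop) measurableSet_Iic]
    congr 1
    ext z
    simp [hcdef]
  rw [hpre]
  -- The density bound is available only on `[Vmin, Vmax]`. Below it the left side vanishes; if `y +
  -- c` is at or beyond `Vmax` the right side is one; otherwise both `y` and `y + c` lie in the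
  -- interval, and the gain `ζ c` covers the estimation error.
  by_cases hy : y < M.Vmin
  · have h0 : returnLaw M pol s a (Iic y) = 0 := by
      rw [measure_eq_zero_iff_ae_notMem]
      filter_upwards [MDP.ae_mem_returnLaw M pol s a] with z hz hzy
      exact absurd (hz.1.trans hzy) (not_le.2 hy)
    rw [h0]
    exact zero_le
  · have hfin : empiricalBellmanOp M pol x ω (returnLaw M pol) s a (Iic M.Vmax) = 1 := by
      have h1 := empiricalBellmanOp_returnLaw_Iic (pol := pol) hn hr le_rfl
      rwa [Measure.real, ENNReal.toReal_eq_one_iff] at h1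
    by_cases hw : M.Vmax ≤ y + c
    · calc returnLaw M pol s a (Iic y) ≤ 1 := prob_le_one
        _ = _ := hfin.symm
        _ ≤ _ := measure_mono (Iic_subset_Iic.2 hw)
    · rw [not_lt] at hy
      rw [not_le] at hw
      have hmono := hreg.mul_sub_le s a (y := y) (w := y + c) ⟨hy, by linarith⟩
        ⟨by linarith, hw.le⟩ (by linarith)
      have hacc := h.bellmanOp_sub_le (pol := pol) hn (returnLaw M pol) (y + c)
      rw [MDP.bellmanOp_returnLaw] at hacc
      have hζc : ε₁ + ε₂ ≤ ζ * (y + c - y) := by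
        rw [div_le_iff₀ hζ] at hc
        linarith
      have hreal : (returnLaw M pol s a).real (Iic y) ≤
          (empiricalBellmanOp M pol x ω (returnLaw M pol) s a).real (Iic (y + c)) := by
        linarith
      exact (ENNReal.toReal_le_toReal (measure_ne_top _ _)
        (ne_top_of_le_ne_top ENNReal.one_ne_top
          (hfin ▸ measure_mono (Iic_subset_Iic.2 hw.le)))).1 hreal

omit [MeasurableSpace S] [MeasurableSpace A]
  [MeasurableSingletonClass S] [MeasurableSingletonClass A] in
-- The lower bound on `α`, raised to the power `1 / (p - 1)`, says that the penalty is at least `Δ`.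
-- With `q = |S| L / n`, the square of `√(2q) + √(q/2)` is `2q + 2q + q/2 = 9q/2`, which the
-- constant 5 in `Δ` covers.
theorem sqrt_add_sqrt_div_le_penalty {p α ζ δ L : ℝ} {c₀ : S → A → ℝ} {s : S} {a : A}
    (hζ : 0 < ζ) (hp : 1 < p) (hc₀ : 0 < c₀ s a) (hα : 0 < α)
    (hL : L = Real.log (4 * Fintype.card S * Fintype.card A / δ)) (hL0 : 0 < L)
    (hlarge : p * estimationError ζ δ x s a ^ (p - 1) / c₀ s a ≤ α) :
    (√(2 * (Fintype.card S / visits x s a * L)) + √(Fintype.card S / visits x s a * L / 2)) / ζ ≤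
      penalty p α c₀ s a := by
  set Δ := estimationError ζ δ x s a with hΔ
  have hΔ0 : 0 ≤ Δ := by
    rw [hΔ, estimationError]; positivity
  have h1 : Δ ≤ penalty p α c₀ s a := by
    rw [penalty, Real.sign_of_pos hc₀, mul_one, abs_of_pos (by positivity)]
    have h2 : Δ ^ (p - 1) ≤ α * p⁻¹ * c₀ s a := by
      rw [div_le_iff₀ hc₀] at hlarge
      rw [mul_right_comm, ← div_eq_mul_inv, le_div_iff₀ (by linarith)]
      linarith
    calc Δ = (Δ ^ (p - 1)) ^ (1 / (p - 1)) := by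
          rw [← Real.rpow_mul hΔ0, mul_one_div_cancel (by linarith), Real.rpow_one]
      _ ≤ _ := Real.rpow_le_rpow (Real.rpow_nonneg hΔ0 _) h2 (by
          rw [one_div, inv_nonneg]; linarith)
  refine le_trans ?_ h1
  rw [hΔ, estimationError, ← hL, div_eq_inv_mul, ← one_div]
  refine mul_le_mul_of_nonneg_left ?_ (by positivity)
  set q := (Fintype.card S : ℝ) / visits x s a * L with hq
  have hq0 : 0 ≤ q := by positivity
  have e : 5 * (Fintype.card S : ℝ) / visits x s a * L = 5 * q := by rw [hq]; ring
  rw [e]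
  refine Real.le_sqrt_of_sq_le ?_
  have hprod : √(2 * q) * √(q / 2) = q := by
    rw [← Real.sqrt_mul (by positivity), show 2 * q * (q / 2) = q * q by ring, Real.sqrt_mul_self hq0]
  rw [add_sq, Real.sq_sqrt (by positivity), Real.sq_sqrt (by positivity), mul_assoc, hprod]
  linarith

end Improvement

/-! ### From ordered CDFs to ordered quantiles and means -/

section Quantiles

variable {μ ν : Measure ℝ} [IsProbabilityMeasure μ] [IsProbabilityMeasure ν]

omit [IsProbabilityMeasure μ] in
theorem quantile_set_nonempty {τ : ℝ} (hτ : τ < 1) : {y | τ ≤ cdf μ y}.Nonempty :=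
  ((tendsto_cdf_atTop μ).eventually (eventually_ge_nhds hτ)).exists

omit [IsProbabilityMeasure μ] in
theorem quantile_set_bddBelow {τ : ℝ} (hτ : 0 < τ) : BddBelow {y | τ ≤ cdf μ y} := by
  obtain ⟨b, hb⟩ := ((tendsto_cdf_atBot μ).eventually (eventually_lt_nhds hτ)).exists
  refine ⟨b, fun y hy => ?_⟩
  by_contra hlt
  exact absurd (hy.trans (monotone_cdf μ (not_le.1 hlt).le)) (not_le.2 hb)

theorem quantile_le_quantile (h : ∀ y, μ (Iic y) ≤ ν (Iic y)) {τ : ℝ} (hτ : τ ∈ Ioo (0 : ℝ) 1) :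
    quantile ν τ ≤ quantile μ τ := by
  refine csInf_le_csInf (quantile_set_bddBelow hτ.1) (quantile_set_nonempty hτ.2) ?_
  intro y (hy : τ ≤ cdf μ y)
  refine hy.trans ?_
  rw [cdf_eq_real, cdf_eq_real]
  exact ENNReal.toReal_mono (measure_ne_top _ _) (h y)

omit [IsProbabilityMeasure μ] in
theorem monotoneOn_quantile : MonotoneOn (quantile μ) (Ioo 0 1) := fun _ hs _ ht hst =>
  csInf_le_csInf (quantile_set_bddBelow hs.1) (quantile_set_nonempty ht.2)
    fun _ hy => hst.trans hy

theorem abs_quantile_le {C : ℝ} (h : ∀ᵐ z ∂μ, |z| ≤ C) {τ : ℝ} (hτ : τ ∈ Ioo (0 : ℝ) 1) :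
    |quantile μ τ| ≤ C := by
  refine abs_le.2 ⟨le_csInf (quantile_set_nonempty hτ.2) fun y (hy : τ ≤ cdf μ y) => ?_,
    csInf_le (quantile_set_bddBelow hτ.1) ?_⟩
  · by_contra hlt
    have h0 : μ (Iic y) = 0 := by
      rw [measure_eq_zero_iff_ae_notMem]
      filter_upwards [h] with z hz hzy
      exact hlt ((abs_le.1 hz).1.trans hzy)
    rw [cdf_eq_real, Measure.real, h0, ENNReal.toReal_zero] at hy
    exact absurd hτ.1 (not_lt.2 hy)
  · have h1 : μ (Iic C) = 1 := by
      refine (mem_ae_iff_prob_eq_one measurableSet_Iic).1 ?_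
      filter_upwards [h] with z hz
      exact (abs_le.1 hz).2
    rw [mem_ofPred, cdf_eq_real, Measure.real, h1, ENNReal.toReal_one]
    exact hτ.2.le

theorem intervalIntegrable_quantile_mul {C : ℝ} (h : ∀ᵐ z ∂μ, |z| ≤ C) {g : ℝ → ℝ} {ξ : ℝ}
    (hξ : ξ ∈ Ioc (0 : ℝ) 1) (hg : IntervalIntegrable g volume 0 ξ) :
    IntervalIntegrable (fun τ => quantile μ τ * g τ) volume 0 ξ := by
  rw [intervalIntegrable_iff_integrableOn_Ioo_of_le hξ.1.le] at hg ⊢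
  have hsub : Ioo 0 ξ ⊆ Ioo (0 : ℝ) 1 := Ioo_subset_Ioo_right hξ.2
  refine hg.bdd_mul (c := C) ?_ ?_
  · exact (aemeasurable_restrict_of_monotoneOn measurableSet_Ioo
      (monotoneOn_quantile.mono hsub)).aestronglyMeasurable
  · exact ae_restrict_of_forall_mem measurableSet_Ioo fun τ hτ => abs_quantile_le h (hsub hτ)

theorem intervalIntegral_quantile_mul_le {C : ℝ} (hμ : ∀ᵐ z ∂μ, |z| ≤ C) (hν : ∀ᵐ z ∂ν, |z| ≤ C)
    (h : ∀ y, μ (Iic y) ≤ ν (Iic y)) {g : ℝ → ℝ} {ξ : ℝ}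
    (hξ : ξ ∈ Ioc (0 : ℝ) 1) (hg : IntervalIntegrable g volume 0 ξ)
    (hg0 : ∀ τ ∈ Icc (0 : ℝ) 1, 0 ≤ g τ) :
    ∫ τ in (0 : ℝ)..ξ, quantile ν τ * g τ ≤ ∫ τ in (0 : ℝ)..ξ, quantile μ τ * g τ := by
  refine intervalIntegral.integral_mono_on_of_le_Ioo hξ.1.le
    (intervalIntegrable_quantile_mul hν hξ hg) (intervalIntegrable_quantile_mul hμ hξ hg)
    fun τ hτ => ?_
  have hτ' : τ ∈ Ioo (0 : ℝ) 1 := ⟨hτ.1, hτ.2.trans_le hξ.2⟩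
  exact mul_le_mul_of_nonneg_right (quantile_le_quantile h hτ')
    (hg0 τ (Ioo_subset_Icc_self hτ'))

/-- Layer-cake formula for the nonnegative variable `C - z`, whose tail probabilities are values of
the CDF; this avoids representing the mean as an integral of quantiles. -/
theorem integral_le_integral_of_measure_Iic_le {C : ℝ} (hμ : ∀ᵐ z ∂μ, |z| ≤ C)
    (hν : ∀ᵐ z ∂ν, |z| ≤ C) (h : ∀ y, μ (Iic y) ≤ ν (Iic y)) :
    ∫ z, z ∂ν ≤ ∫ z, z ∂μ := by
  have hint : ∀ ρ : Measure ℝ, [IsProbabilityMeasure ρ] → (∀ᵐ z ∂ρ, |z| ≤ C) →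
      Integrable (fun z => z) ρ := fun ρ _ hρ => Integrable.of_bound (by fun_prop) C hρ
  have hrep : ∀ ρ : Measure ℝ, [IsProbabilityMeasure ρ] → (∀ᵐ z ∂ρ, |z| ≤ C) →
      ENNReal.ofReal (C - ∫ z, z ∂ρ) = ∫⁻ t in Ioi (0 : ℝ), ρ (Iic (C - t)) := by
    intro ρ _ hρ
    have hnn : 0 ≤ᵐ[ρ] fun z => C - z := by
      filter_upwards [hρ] with z hz
      exact sub_nonneg.2 (abs_le.1 hz).2
    have hI : Integrable (fun z => C - z) ρ := (integrable_const C).sub (hint ρ hρ)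
    have e : ∫ z, (C - z) ∂ρ = C - ∫ z, z ∂ρ := by
      rw [integral_sub (integrable_const C) (hint ρ hρ)]
      simp
    rw [← e, ofReal_integral_eq_lintegral_ofReal hI hnn,
      lintegral_eq_lintegral_meas_le _ hnn hI.aemeasurable]
    refine lintegral_congr fun t => ?_
    congr 1
    ext z
    simp only [mem_ofPred, mem_Iic]
    constructor <;> intro h <;> linarith
  have hle : ENNReal.ofReal (C - ∫ z, z ∂μ) ≤ ENNReal.ofReal (C - ∫ z, z ∂ν) := by
    rw [hrep μ hμ, hrep ν hν]
    exact lintegral_mono fun t => h _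
  have hC : ∫ z, z ∂ν ≤ C := by
    calc ∫ z, z ∂ν ≤ ∫ _, C ∂ν := integral_mono_ae (hint ν hν) (integrable_const C) (by
          filter_upwards [hν] with z hz
          exact (abs_le.1 hz).2)
      _ = C := by simp
  have := (ENNReal.ofReal_le_ofReal_iff (by linarith)).1 hle
  linarith

end Quantiles

/-! ### The main theorem -/

theorem mainTheorem3 {S A : Type*} [Fintype S] [Fintype A] [DecidableEq S] [DecidableEq A]
    [MeasurableSpace S] [MeasurableSpace A]
    [MeasurableSingletonClass S] [MeasurableSingletonClass A]
    (M : MDP S A) (pol : S → PMF A)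
    (ζ : ℝ) (hζ : 0 < ζ) (hreg : StronglyMonotoneReturns M pol ζ)
    (p : ℝ) (hp : 1 < p)
    (c₀ : S → A → ℝ) (hc₀ : ∀ s a, 0 < c₀ s a)
    (δ : ℝ) (hδ : 0 < δ)
    {N : ℕ} (x : Fin N → S × A)
    (α : ℝ) (hα : 0 < α)
    (hα_large : ∀ s a, 0 < visits x s a →
      p * estimationError ζ δ x s a ^ (p - 1) / c₀ s a ≤ α) :
    (∀ ω : Fin N → ℝ × S, Covers x ω →
      ∃ Z, IsCDEFixedPoint M pol p α c₀ x ω Z ∧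
        ∀ Z', IsCDEFixedPoint M pol p α c₀ x ω Z' →
          ∀ s ∈ dataStates x ω, ∀ a, Z' s a = Z s a) ∧
    ∃ E : Set (Fin N → ℝ × S), MeasurableSet E ∧ 1 - ENNReal.ofReal δ ≤ dataLaw M x E ∧
      ∀ ω ∈ E, Covers x ω → ∀ Z, IsCDEFixedPoint M pol p α c₀ x ω Z →
        ∀ s ∈ dataStates x ω, ∀ a,
          (∀ g, IsDistortionDensity g →
            IntervalIntegrable (fun τ => quantile (Z s a) τ * g τ) volume 0 1 ∧
            IntervalIntegrable (fun τ => quantile (returnLaw M pol s a) τ * g τ) volume 0 1 ∧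
            distortedExpectation g (Z s a) ≤ distortedExpectation g (returnLaw M pol s a)) ∧
          ∫ z, z ∂(Z s a) ≤ qFunction M pol s a ∧
          ∀ ξ ∈ Set.Ioc (0 : ℝ) 1, cvar ξ (Z s a) ≤ cvar ξ (returnLaw M pol s a) := by
  refine ⟨fun ω hω => ⟨_, isCDEFixedPoint_returnLaw_empirical hp hω, fun Z' hZ' =>
    (isCDEFixedPoint_returnLaw_empirical hp hω).unique hω hp hZ'⟩, ?_⟩
  obtain ⟨E, hE, hEδ, hgood⟩ := exists_event_isAccurate M x hδ rfl
  refine ⟨E, hE, hEδ, fun ω hω hcov Z hZ => ?_⟩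
  obtain ⟨hrew, hacc⟩ := hgood ω hω
  have hCπ : ∀ s a, ∀ᵐ z ∂(returnLaw M pol s a), |z| ≤ max |M.Vmin| |M.Vmax| := by
    intro s a
    filter_upwards [MDP.ae_mem_returnLaw M pol s a] with z hz
    exact abs_le_max_abs_abs hz.1 hz.2
  have hle := hZ.measure_Iic_le hcov hp (U := returnLaw M pol) (fun s _ a => inferInstance)
    (fun s _ a => Integrable.of_bound (by fun_prop) _ (hCπ s a)) fun s hs a y => by
      have hn := hcov.visits_pos hs a
      obtain ⟨hL, h⟩ := hacc s a hn
      exact returnLaw_Iic_le_cdeOp hζ hreg h hn (fun i => (hrew i).2)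
        (add_nonneg (Real.sqrt_nonneg _) (Real.sqrt_nonneg _))
        (sqrt_add_sqrt_div_le_penalty hζ hp (hc₀ s a) hα rfl hL (hα_large s a hn)) y
  intro s hs a
  -- By uniqueness the fixed point is the return law of the lowered empirical process, so its
  -- support is bounded. Its quantiles are then bounded, and their product with any integrable
  -- density is integrable.
  have hZs := (isCDEFixedPoint_returnLaw_empirical hp hcov).unique hcov hp hZ s hs a
  have := (hZ s hs a).1
  set C := max (max |M.Vmin| |M.Vmax|) (M.empirical x ω (penalty p α c₀)).Vmax
  have hC1 : ∀ᵐ z ∂(returnLaw M pol s a), |z| ≤ C := by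
    filter_upwards [hCπ s a] with z hz using hz.trans (le_max_left _ _)
  have hC2 : ∀ᵐ z ∂(Z s a), |z| ≤ C := by
    rw [hZs]
    filter_upwards [M.ae_abs_returnLaw_empirical pol (penalty p α c₀) s a] with z hz
      using hz.trans (le_max_right _ _)
  refine ⟨fun g hg => ⟨intervalIntegrable_quantile_mul hC2 ⟨zero_lt_one, le_rfl⟩ hg.2.1,
    intervalIntegrable_quantile_mul hC1 ⟨zero_lt_one, le_rfl⟩ hg.2.1,
    intervalIntegral_quantile_mul_le hC1 hC2 (hle s hs a) ⟨zero_lt_one, le_rfl⟩ hg.2.1 hg.1⟩, ?_,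
    fun ξ hξ => ?_⟩
  · rw [MDP.qFunction_eq]
    exact integral_le_integral_of_measure_Iic_le hC1 hC2 (hle s hs a)
  -- Quantiles are compared directly on `[0, ξ]` with constant weight one.
  · refine mul_le_mul_of_nonneg_left ?_ (inv_nonneg.2 hξ.1.le)
    simpa using intervalIntegral_quantile_mul_le hC1 hC2 (hle s hs a) hξ
      (g := fun _ => 1) intervalIntegrable_const fun _ _ => zero_le_one
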